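/- Let $\kappa>0$, $\lambda\in\mathbb C$, $L\ge 10$, $\Lambda=[1,L]=\{1,\dots,L\}$, and write $L=3N+k$ with $k\in\{1,2,3\}$. Let $\mathcal H_\Lambda=\bigotimes_{x=1}^L\mathbb C^2$ with occupation basis $|\mu\rangle$, $\mu\in\{0,1\}^L$; let $\sigma_x^-$ be the lowering operator at site $x$ ($|1\rangle\mapsto|0\rangle$, $|0\rangle\mapsto 0$), $n_x=(\sigma_x^-)^*\sigma_x^-$ and $q_x=\sigma^-_{x+1}\sigma^-_{x+2}-\lambda\,\sigma^-_x\sigma^-_{x+3}$. For $[a,b]\subseteq\Lambda$ put $$H_{[a,b]}=\sum_{x=a}^{b-2}n_xn_{x+2}+\kappa\sum_{x=a}^{b-3}q_x^*q_x ,$$ acting as the identity outside $[a,b]$. A BVMD tiling of $[1,\ell]$ is an ordered sequence of tiles covering exactly the $\ell$ sites, with bulk tiles $V=(0)$, $M=(100)$, $D=(011000)$, the tile $B_l=(11000)$, allowed only as the first tile, and the tiles $M_1=(1)$, $M_2=(10)$, $D_1=(0110)$, $D_2=(01100)$, $B_r=(011)$, allowed only as the last tile. Let $\sigma(T)\in\{0,1\}^\ell$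 be the configuration of $T$, and let $\mathcal C_\Lambda$ be the span of all $|\sigma(T)\rangle$, $T$ a BVMD tiling of $\Lambda$. Tilings are connected, $T\leftrightarrow T'$, if one is transformed into the other by finitely many replacements $MM\leftrightarrow D$, $MM_2\leftrightarrow D_2$, $MM_1\leftrightarrow D_1$ (the last two at the right end). With $d(T)$ the number of dimers $D,D_1,D_2$ in $T$, let $\varphi_n=\sum_{T\leftrightarrow (M,\dots,M)}\lambda^{d(T)}|\sigma(T)\rangle$ be the state on $3n$ sites associated with the tiling by $n$ monomers. For $2\le n\le N$ let $\Lambda_2=[1,6+k]$ and $\Lambda_n=[3n+k-8,3n+k]$ for $n>2$; let $h_n=H_{\Lambda_n}$ and $H_n=\sum_{m=2}^n h_m$, and let $g_n$, $G_n$ be the orthogonal projections onto $\ker h_n$, $\ker H_n$. Let $E_1=1-G_2$, $E_n=G_n-G_{n+1}$ for $2\le n\le N-1$, and $E_N=G_N$. The space $\mathcal C_\Lambda$ is invariant under $H_\Lambda$ and under all $h_n,H_n,g_n$ ($2\le n\le N$) and $E_m$ ($1\le m\le N$); write $A^{\mathcal C_\Lambda}=P_{\mathcal C_\Lambda}AP_{\mathcal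 C_\Lambda}$ for the restriction of $A$, with $P_{\mathcal C_\Lambda}$ the orthogonal projection onto $\mathcal C_\Lambda$. Let $$\beta_n=\frac{\|\varphi_{n-1}\|^2}{\|\varphi_n\|^2}=\frac1{\beta_+}\,\frac{1-\beta^n}{1-\beta^{n+1}}\quad(n\ge1),\qquad \beta_\pm=\tfrac12\bigl(1\pm\sqrt{1+4|\lambda|^2}\bigr),\quad \beta=\beta_- /\beta_+ ,$$ (both the invariance and this equality being part of the claim), which is a function of $r=|\lambda|^2$, and let $f(r)=\sup_{j\ge4}f_j(r)$, which is finite, where $$f_j(r)=r\,\beta_j\beta_{j-2}\left(\frac{[1-\beta_{j-1}(1+r)]^2}{1+2r}+\beta_{j-3}\frac{r(1-\beta_{j-1})^2}{1+r}\right).$$ Then for all $2\le n\le N$: 1. $h_n^{\mathcal C_\Lambda}\ge\kappa(1-g_n)^{\mathcal C_\Lambda}$; 2. for $1\le m\le N$, $[g_n^{\mathcal C_\Lambda},E_m^{\mathcal C_\Lambda}]\ne0$ only if $n-3\le m\le n-1$; 3. if $\lambda\ne0$, then $\|g_n^{\mathcal C_\Lambda}E_{n-1}^{\mathcal C_\Lambda}\|^2\le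 f(|\lambda|^2)$. Consequently, if $\lambda\ne0$ and $f(|\lambda|^2)<1/3$, the spectral gap of $H_\Lambda$ restricted to $\mathcal C_\Lambda$ satisfies $$E_1(\mathcal C_\Lambda):=\inf_{0\ne\psi\in\mathcal C_\Lambda\cap(\ker H_\Lambda)^\perp}\frac{\langle\psi,H_\Lambda\psi\rangle}{\|\psi\|^2}\ \ge\ \frac{\kappa}{3}\Bigl(1-\sqrt{3f(|\lambda|^2)}\Bigr)^2 .$$ -/

import Mathlib

namespace FQH

noncomputable section

/-! ### Configurations, Hilbert space, Hamiltonians -/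

/-- Occupation configurations of the sites `1, …, L`; site `x` is the index `x - 1 : Fin L`. -/
abbrev Config (L : ℕ) : Type := Fin L → Bool

/-- The `L`-fold tensor power of `ℂ²`, written in its orthonormal occupation basis. -/
abbrev Hilb (L : ℕ) : Type := EuclideanSpace ℂ (Config L)

/-- Bounded operators on the Hilbert space. -/
abbrev Op (L : ℕ) : Type := Hilb L →L[ℂ] Hilb L

/-- The lowering operator at an index: it maps `|1⟩` to `|0⟩` and `|0⟩` to `0` there, and is the
identity on the other tensor factors. -/
def lower {L : ℕ} (i : Fin L) : Op L :=
  LinearMap.toContinuousLinearMap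
    { toFun := fun ψ => WithLp.toLp 2 fun μ : Config L =>
        if μ i = false then ψ (Function.update μ i true) else 0
      map_add' := fun ψ χ => by
        ext μ
        by_cases h : μ i = false <;> simp [h]
      map_smul' := fun c ψ => by
        ext μ
        by_cases h : μ i = false <;> simp [h] }

/-- The lowering operator `σ_x⁻` at the site `x ∈ [1, L]` (only such sites are ever used). -/
def sigmaMinus (L x : ℕ) : Op L :=
  if h : 1 ≤ x ∧ x ≤ L then lower ⟨x - 1, by omega⟩ else 0

/-- The number operator `n_x = σ_x⁺ σ_x⁻`. -/
def num (L x : ℕ) : Op L := star (sigmaMinus L x) * sigmaMinus L x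

/-- `q_x = σ_{x+1}⁻ σ_{x+2}⁻ - lam σ_x⁻ σ_{x+3}⁻`. -/
def q (L : ℕ) (lam : ℂ) (x : ℕ) : Op L :=
  sigmaMinus L (x + 1) * sigmaMinus L (x + 2) - lam • (sigmaMinus L x * sigmaMinus L (x + 3))

/-- The Hamiltonian with open boundary conditions of the interval `[a, b]`, `1 ≤ a`, `b ≤ L`,
acting on the Hilbert space of `[1, L]` (it is tensored with the identity outside `[a, b]`). -/
def Ham (L : ℕ) (κ : ℝ) (lam : ℂ) (a b : ℕ) : Op L :=
  ∑ x ∈ Finset.Icc a (b - 2), num L x * num L (x + 2)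
    + (κ : ℂ) • ∑ x ∈ Finset.Icc a (b - 3), star (q L lam x) * q L lam x

/-- The orthogonal projection onto the kernel of an operator. -/
def kerProj {L : ℕ} (A : Op L) : Op L := (LinearMap.ker A.toLinearMap).starProjection

/-! ### Tilings -/

/-- Voids `V`, monomers `M`, dimers `D`, and the boundary tiles. -/
inductive Tile : Type
  | V | M | D | Bl | M1 | M2 | D1 | D2 | Br

/-- The occupation numbers on the sites covered by a tile. -/
def Tile.word : Tile → List Bool
  | .V => [false]
  | .M => [true, false, false]
  | .D => [false, true, true, false, false, false]
  | .Bl => [true, true, false, false, false]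
  | .M1 => [true]
  | .M2 => [true, false]
  | .D1 => [false, true, true, false]
  | .D2 => [false, true, true, false, false]
  | .Br => [false, true, true]

/-- The configuration of an ordered list of tiles, as a word. -/
def conf (T : List Tile) : List Bool := T.flatMap Tile.word

/-- `T` is a BVMD tiling of `[1, L]`: its tiles cover exactly `L` sites, the left boundary tile
occurs at most in the first place, the right boundary tiles at most in the last place. -/
structure IsBVMD (L : ℕ) (T : List Tile) : Prop where
  covers : (conf T).length = L
  left : Tile.Bl ∉ T.tail
  right : ∀ t ∈ T.dropLast, t = Tile.V ∨ t = Tile.M ∨ t = Tile.D ∨ t = Tile.Bl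

/-- The occupation basis vector of a word of length `L`. -/
def ket (L : ℕ) (w : List Bool) : Hilb L :=
  EuclideanSpace.single (fun i : Fin L => w.getD i false) 1

/-- The space `C_Λ` of all BVMD tilings of `Λ = [1, L]`. -/
def tilingSpace (L : ℕ) : Submodule ℂ (Hilb L) :=
  Submodule.span ℂ {v | ∃ T : List Tile, IsBVMD L T ∧ v = ket L (conf T)}

/-- The replacement rules. -/
inductive Replace : List Tile → List Tile → Prop
  | bulk (A B : List Tile) : Replace (A ++ [.M, .M] ++ B) (A ++ [.D] ++ B)
  | two (A : List Tile) : Replace (A ++ [.M, .M2]) (A ++ [.D2])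
  | one (A : List Tile) : Replace (A ++ [.M, .M1]) (A ++ [.D1])

/-- Two tilings are connected if finitely many replacements, in either direction, transform one
into the other. -/
def Connected : List Tile → List Tile → Prop := Relation.EqvGen Replace

/-- One for the dimers `D`, `D1`, `D2`, zero for all other tiles. -/
def Tile.dimers : Tile → ℕ
  | .D => 1
  | .D1 => 1
  | .D2 => 1
  | _ => 0

/-- The number `d(T)` of dimers `D`, `D1`, `D2` in a tiling. -/
def dimerCount (T : List Tile) : ℕ := (T.map Tile.dimers).sum

instance : Finite Tile := by
  refine Finite.of_surjective
    (fun i : Fin 9 => ([.V, .M, .D, .Bl, .M1, .M2, .D1, .D2, .Br] : List Tile).get i) ?_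
  intro t
  cases t
  exacts [⟨0, rfl⟩, ⟨1, rfl⟩, ⟨2, rfl⟩, ⟨3, rfl⟩, ⟨4, rfl⟩, ⟨5, rfl⟩, ⟨6, rfl⟩, ⟨7, rfl⟩, ⟨8, rfl⟩]

theorem length_le_length_conf (T : List Tile) : T.length ≤ (conf T).length := by
  induction T with
  | nil => simp
  | cons t T ih =>
    have h : 1 ≤ t.word.length := by cases t <;> simp [Tile.word]
    simp only [conf, List.flatMap_cons, List.length_append, List.length_cons] at ih ⊢
    omega

theorem finite_connected (L : ℕ) (R : List Tile) :
    {T | IsBVMD L T ∧ Connected T R}.Finite :=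
  (List.finite_length_le Tile L).subset fun T hT => by
    have := length_le_length_conf T
    rw [hT.1.covers] at this
    exact this

/-- The BVMD state `∑_{T ↔ R} lam ^ d(T) |σ(T)⟩` of a root tiling `R` of `[1, L]`. -/
def bvmdState (L : ℕ) (lam : ℂ) (R : List Tile) : Hilb L :=
  ∑ T ∈ (finite_connected L R).toFinset, lam ^ dimerCount T • ket L (conf T)

/-- The squeezed Tao–Thouless state `φ_n` of the root tiling by `n` monomers. -/
def phi (lam : ℂ) (n : ℕ) : Hilb (3 * n) := bvmdState (3 * n) lam (List.replicate n Tile.M)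

/-! ### The function `f` -/

def betaPlus (r : ℝ) : ℝ := (1 + √(1 + 4 * r)) / 2

def betaMinus (r : ℝ) : ℝ := (1 - √(1 + 4 * r)) / 2

/-- The ratios `β_n`, `n ≥ 1`, as a function of `r = |lam|²`. -/
def beta (r : ℝ) (n : ℕ) : ℝ :=
  1 / betaPlus r * ((1 - (betaMinus r / betaPlus r) ^ n)
    / (1 - (betaMinus r / betaPlus r) ^ (n + 1)))

/-- `f_k(r)`, for `k ≥ 4`. -/
def fk (k : ℕ) (r : ℝ) : ℝ :=
  r * beta r k * beta r (k - 2) *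
    ((1 - beta r (k - 1) * (1 + r)) ^ 2 / (1 + 2 * r)
      + beta r (k - 3) * (r * (1 - beta r (k - 1)) ^ 2 / (1 + r)))

/-- `f(r) = sup_{k ≥ 4} f_k(r)`. -/
def f (r : ℝ) : ℝ := sSup ((fun k => fk k r) '' Set.Ici 4)

/-! ### The operators of the martingale method, for `L = 3 N + k` -/

/-- The left end of `Λ_n`; the right end is `3 n + k`. -/
def leftEnd (k n : ℕ) : ℕ := if n = 2 then 1 else 3 * n + k - 8

/-- `h_n = H_{Λ_n}`. -/
def hLoc (L : ℕ) (κ : ℝ) (lam : ℂ) (k n : ℕ) : Op L :=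
  Ham L κ lam (leftEnd k n) (3 * n + k)

/-- `H_n = ∑_{m=2}^n h_m`. -/
def hSum (L : ℕ) (κ : ℝ) (lam : ℂ) (k n : ℕ) : Op L :=
  ∑ m ∈ Finset.Icc 2 n, hLoc L κ lam k m

/-- `g_n`, the orthogonal projection onto `ker h_n`. -/
def gProj (L : ℕ) (κ : ℝ) (lam : ℂ) (k n : ℕ) : Op L := kerProj (hLoc L κ lam k n)

/-- `G_n`, the orthogonal projection onto `ker H_n`. -/
def GProj (L : ℕ) (κ : ℝ) (lam : ℂ) (k n : ℕ) : Op L := kerProj (hSum L κ lam k n)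

/-- `E_n`, for `1 ≤ n ≤ N`. -/
def EProj (L : ℕ) (κ : ℝ) (lam : ℂ) (N k n : ℕ) : Op L :=
  if n = 1 then 1 - GProj L κ lam k 2
  else if n < N then GProj L κ lam k n - GProj L κ lam k (n + 1)
  else GProj L κ lam k N

/-- The restriction `A^C = P_C A P_C` of an operator to `C = C_Λ`, with `P_C` the orthogonal
projection onto `C`. -/
def restr {L : ℕ} (A : Op L) : Op L :=
  (tilingSpace L).starProjection * A * (tilingSpace L).starProjection

/-- `A` maps `C_Λ` into itself. -/
def LeavesInvariant {L : ℕ} (A : Op L) : Prop := ∀ ψ ∈ tilingSpace L, A ψ ∈ tilingSpace L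

/-- The spectral gap `E₁(C_Λ)` of the restriction of `H_Λ` to `C_Λ`, `Λ = [1, L]`: the infimum of
`⟨ψ, H_Λ ψ⟩ / ‖ψ‖²` over the nonzero vectors of `C_Λ` orthogonal to `ker H_Λ`. -/
def E1 (L : ℕ) (κ : ℝ) (lam : ℂ) : ℝ :=
  sInf {e | ∃ ψ ∈ tilingSpace L ⊓ (LinearMap.ker (Ham L κ lam 1 L).toLinearMap)ᗮ, ψ ≠ 0 ∧
    e = (inner ℂ ψ (Ham L κ lam 1 L ψ)).re / ‖ψ‖ ^ 2}

end

end FQH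

/-!
Surrounding `[1, L]` by empty sites turns every boundary tile into bulk tiles, so that the tiling
space has an orthogonal basis indexed by tilings with `V`, `M`, `D` only. On it the electrostatic
terms vanish, and `q_x` compares the amplitude of a dimer on the bond `[x, x + 3]` with that of the
two monomers it replaces: the ground states of `H_{[a,b]}` are the vectors whose amplitudes satisfy
`F(X D Y) = λ F(X M M Y)` for all bonds inside `[a, b]`. At most one dimer fits into an interval of
nine sites, hence restoring this relation on the dimer configurations gives a nearby ground state of
`h_n` at a squared distance at most the energy divided by `κ`.

For the overlap of `g_n` with `E_{n-1}` only the last maximal run of monomers and dimers matters.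
There a vector in the range of `E_{n-1}` is fixed by two numbers, its amplitudes with a monomer and
with a dimer at the right end, and orthogonality to the ground states is one linear relation between
them. The sums over the remaining tiles are norms `‖φ_j‖²`, for which
`‖φ_{j+2}‖² = ‖φ_{j+1}‖² + r ‖φ_j‖²` with `r = |λ|²`, and Cauchy–Schwarz produces `f_j(r)`. The gap
then follows from the martingale method: `g_n` commutes with all but three of the increments of
`G_n`, and each `1 - g_n` costs energy `κ`, while `∑ h_n ≤ 3 H`.
-/

namespace FQH

noncomputable section

/-! ### The local operators in the occupation basis -/

variable {L : ℕ}

lemma lower_apply (i : Fin L) (ψ : Hilb L) (μ : Config L) :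
    lower i ψ μ = if μ i = false then ψ (Function.update μ i true) else 0 := rfl

lemma star_lower_apply (i : Fin L) (ψ : Hilb L) (μ : Config L) :
    star (lower i) ψ μ = if μ i = true then ψ (Function.update μ i false) else 0 := by
  have matrix_element := ContinuousLinearMap.adjoint_inner_right (lower i)
    (EuclideanSpace.single μ 1) ψ
  rw [EuclideanSpace.inner_single_left, map_one, one_mul] at matrix_element
  rw [ContinuousLinearMap.star_eq_adjoint, matrix_element, PiLp.inner_apply]
  have lower_single (ν : Config L) : lower i (EuclideanSpace.single μ 1) ν =
      if ν = Function.update μ i false ∧ μ i = true then 1 else 0 := by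
    rw [lower_apply, PiLp.single_apply, ← ite_and]
    refine if_congr ⟨?_, ?_⟩ rfl rfl
    · rintro ⟨hν, rfl⟩
      simp [← hν]
    · rintro ⟨rfl, hμ⟩
      simp [← hμ]
  simp only [lower_single]
  split_ifs with hμ <;> simp [hμ, apply_ite]

lemma commute_lower (i j : Fin L) : Commute (lower i) (lower j) := by
  rcases eq_or_ne i j with rfl | hij
  · exact Commute.refl _
  ext ψ μ
  change lower i (lower j ψ) μ = lower j (lower i ψ) μ
  simp only [lower_apply, Function.update_of_ne hij, Function.update_of_ne hij.symm,
    Function.update_comm hij]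
  split_ifs <;> rfl

lemma commute_lower_star_lower {i j : Fin L} (hij : i ≠ j) :
    Commute (lower i) (star (lower j)) := by
  ext ψ μ
  change lower i (star (lower j) ψ) μ = star (lower j) (lower i ψ) μ
  simp only [lower_apply, star_lower_apply, Function.update_of_ne hij,
    Function.update_of_ne hij.symm, Function.update_comm hij]
  split_ifs <;> rfl

lemma sigmaMinus_eq_lower {x : ℕ} (h1 : 1 ≤ x) (h2 : x ≤ L) :
    sigmaMinus L x = lower ⟨x - 1, by omega⟩ := dif_pos ⟨h1, h2⟩

lemma sigmaMinus_mem_centralizer {x y : ℕ} (h : x ≠ y) :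
    sigmaMinus L y ∈ StarSubalgebra.centralizer ℂ {sigmaMinus L x} := by
  simp only [StarSubalgebra.mem_centralizer_iff, Set.mem_singleton_iff, forall_eq]
  unfold sigmaMinus
  split_ifs with hx hy hy
  · have hij : (⟨y - 1, by omega⟩ : Fin L) ≠ ⟨x - 1, by omega⟩ := by
      simp only [ne_eq, Fin.mk.injEq]
      omega
    exact ⟨commute_lower _ _, (commute_lower_star_lower hij).symm⟩
  all_goals simp only [mul_zero, zero_mul, star_zero, and_self]

lemma ham_mem_of_sigmaMinus_mem {S : StarSubalgebra ℂ (Op L)} {κ : ℝ} {lam : ℂ} {a b : ℕ}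
    (hab : a + 3 ≤ b) (hS : ∀ y, a ≤ y → y ≤ b → sigmaMinus L y ∈ S) : Ham L κ lam a b ∈ S := by
  have num_mem (y : ℕ) (ha : a ≤ y) (hb : y ≤ b) : num L y ∈ S :=
    mul_mem (star_mem (hS y ha hb)) (hS y ha hb)
  refine add_mem (sum_mem fun x hx => ?_) (S.smul_mem (sum_mem fun x hx => ?_) _) <;>
    rw [Finset.mem_Icc] at hx
  · exact mul_mem (num_mem x (by omega) (by omega)) (num_mem _ (by omega) (by omega))
  · have q_mem : q L lam x ∈ S :=
      sub_mem (mul_mem (hS _ (by omega) (by omega)) (hS _ (by omega) (by omega)))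
        (S.smul_mem (mul_mem (hS _ (by omega) (by omega)) (hS _ (by omega) (by omega))) lam)
    exact mul_mem (star_mem q_mem) q_mem

lemma commute_ham_of_disjoint {κ : ℝ} {lam : ℂ} {a b c d : ℕ} (hab : a + 3 ≤ b)
    (hcd : c + 3 ≤ d) (h : b < c) : Commute (Ham L κ lam a b) (Ham L κ lam c d) := by
  have right_mem (y : ℕ) (hy : y ≤ b) :
      Ham L κ lam c d ∈ StarSubalgebra.centralizer ℂ {sigmaMinus L y} :=
    ham_mem_of_sigmaMinus_mem hcd fun z hc _ => sigmaMinus_mem_centralizer (by omega)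
  have left_mem : Ham L κ lam a b ∈ StarSubalgebra.centralizer ℂ {Ham L κ lam c d} := by
    refine ham_mem_of_sigmaMinus_mem hab fun y _ hb => ?_
    have h1 := right_mem y hb
    have h2 := star_mem h1
    simp only [StarSubalgebra.mem_centralizer_iff, Set.mem_singleton_iff, forall_eq] at h1 h2 ⊢
    exact ⟨h1.1.symm, h2.1.symm⟩
  exact ((StarSubalgebra.mem_centralizer_iff ℂ).1 left_mem _ rfl).1.symm

lemma commute_num {x y : ℕ} (h : x ≠ y) : Commute (num L x) (num L y) := by
  have hy : num L y ∈ StarSubalgebra.centralizer ℂ {sigmaMinus L x} :=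
    mul_mem (star_mem (sigmaMinus_mem_centralizer h)) (sigmaMinus_mem_centralizer h)
  obtain ⟨h1, h2⟩ := (StarSubalgebra.mem_centralizer_iff ℂ).1 hy _ rfl
  exact Commute.mul_left h2 h1

lemma num_apply {x : ℕ} (h1 : 1 ≤ x) (h2 : x ≤ L) (ψ : Hilb L) (μ : Config L) :
    num L x ψ μ = if μ ⟨x - 1, by omega⟩ = true then ψ μ else 0 := by
  rw [num, sigmaMinus_eq_lower h1 h2, mul_apply_eq_comp, star_lower_apply]
  refine if_ctx_congr Iff.rfl (fun h => ?_) fun _ => rfl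
  rw [lower_apply, if_pos (Function.update_self ..), Function.update_idem, ← h,
    Function.update_eq_self]

/-- The configuration `μ` with the occupation numbers at the two indices `i` and `j` set to `c`. -/
def setPair (i j : Fin L) (c : Bool) (μ : Config L) : Config L :=
  Function.update (Function.update μ i c) j c

lemma lower_mul_lower_apply {i j : Fin L} (hij : i ≠ j) (ψ : Hilb L) (μ : Config L) :
    (lower i * lower j) ψ μ =
      if μ i = false ∧ μ j = false then ψ (setPair i j true μ) else 0 := by
  rw [mul_apply_eq_comp, lower_apply, lower_apply, Function.update_of_ne hij.symm, ite_and]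
  rfl

lemma star_lower_mul_lower_apply {i j : Fin L} (hij : i ≠ j) (ψ : Hilb L) (μ : Config L) :
    star (lower i * lower j) ψ μ =
      if μ i = true ∧ μ j = true then ψ (setPair i j false μ) else 0 := by
  rw [(commute_lower i j).eq, star_mul, mul_apply_eq_comp, star_lower_apply, star_lower_apply,
    Function.update_of_ne hij.symm, ite_and]
  rfl

lemma q_eq_lower {x : ℕ} (h1 : 1 ≤ x) (h2 : x + 3 ≤ L) (lam : ℂ) :
    q L lam x = lower ⟨x, by omega⟩ * lower ⟨x + 1, by omega⟩
      - lam • (lower ⟨x - 1, by omega⟩ * lower ⟨x + 2, by omega⟩) := by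
  unfold q
  rw [sigmaMinus_eq_lower h1 (by omega), sigmaMinus_eq_lower (by omega) (by omega),
    sigmaMinus_eq_lower (by omega) (by omega), sigmaMinus_eq_lower (by omega) (by omega)]
  rfl

lemma q_apply {x : ℕ} (h1 : 1 ≤ x) (h2 : x + 3 ≤ L) (lam : ℂ) (ψ : Hilb L) (μ : Config L) :
    q L lam x ψ μ =
      (if μ ⟨x, by omega⟩ = false ∧ μ ⟨x + 1, by omega⟩ = false then
        ψ (setPair ⟨x, by omega⟩ ⟨x + 1, by omega⟩ true μ) else 0)
      - lam * if μ ⟨x - 1, by omega⟩ = false ∧ μ ⟨x + 2, by omega⟩ = false then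
        ψ (setPair ⟨x - 1, by omega⟩ ⟨x + 2, by omega⟩ true μ) else 0 := by
  have h12 : (⟨x, by omega⟩ : Fin L) ≠ ⟨x + 1, by omega⟩ := by simp
  have h03 : (⟨x - 1, by omega⟩ : Fin L) ≠ ⟨x + 2, by omega⟩ := by
    simp only [ne_eq, Fin.mk.injEq]
    omega
  rw [q_eq_lower h1 h2, ← lower_mul_lower_apply h12, ← lower_mul_lower_apply h03]
  rfl

lemma star_q_apply {x : ℕ} (h1 : 1 ≤ x) (h2 : x + 3 ≤ L) (lam : ℂ) (ψ : Hilb L)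
    (μ : Config L) :
    star (q L lam x) ψ μ =
      (if μ ⟨x, by omega⟩ = true ∧ μ ⟨x + 1, by omega⟩ = true then
        ψ (setPair ⟨x, by omega⟩ ⟨x + 1, by omega⟩ false μ) else 0)
      - star lam * if μ ⟨x - 1, by omega⟩ = true ∧ μ ⟨x + 2, by omega⟩ = true then
        ψ (setPair ⟨x - 1, by omega⟩ ⟨x + 2, by omega⟩ false μ) else 0 := by
  have h12 : (⟨x, by omega⟩ : Fin L) ≠ ⟨x + 1, by omega⟩ := by simp
  have h03 : (⟨x - 1, by omega⟩ : Fin L) ≠ ⟨x + 2, by omega⟩ := by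
    simp only [ne_eq, Fin.mk.injEq]
    omega
  rw [q_eq_lower h1 h2, ContinuousLinearMap.star_eq_adjoint, map_sub, map_smulₛₗ,
    ← star_lower_mul_lower_apply h12, ← star_lower_mul_lower_apply h03]
  rfl

/-! ### Padded tilings -/

/-- The bulk tiles `V`, `M`, `D`. -/
def Tile.IsBulk (t : Tile) : Prop := t = V ∨ t = M ∨ t = D

/-- The number of sites covered by a list of tiles. -/
def size (T : List Tile) : ℕ := (conf T).length

/-- The occupation number of the `i`-th site covered by `T`, counted from zero; the sites beyond
the last tile are empty. -/
def occupied (T : List Tile) (i : ℕ) : Bool := (conf T).getD i false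

@[simp] lemma conf_nil : conf [] = [] := rfl

@[simp] lemma conf_cons (t : Tile) (T : List Tile) : conf (t :: T) = t.word ++ conf T := rfl

@[simp] lemma conf_append (X Y : List Tile) : conf (X ++ Y) = conf X ++ conf Y :=
  List.flatMap_append

@[simp] lemma size_nil : size [] = 0 := rfl

@[simp] lemma size_cons (t : Tile) (T : List Tile) : size (t :: T) = t.word.length + size T := by
  simp [size]

@[simp] lemma size_append (X Y : List Tile) : size (X ++ Y) = size X + size Y := by
  simp [size]

lemma Tile.length_word_pos (t : Tile) : 0 < t.word.length := by
  cases t <;> simp [word]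

lemma size_pos {T : List Tile} (hT : T ≠ []) : 0 < size T := by
  obtain ⟨t, T, rfl⟩ := List.exists_cons_of_ne_nil hT
  have := t.length_word_pos
  rw [size_cons]
  omega

lemma occupied_append (X Y : List Tile) (i : ℕ) :
    occupied (X ++ Y) i = if i < size X then occupied X i else occupied Y (i - size X) := by
  unfold occupied
  split_ifs with h
  · rw [conf_append, List.getD_append _ _ _ _ h]
  · rw [conf_append, List.getD_append_right _ _ _ _ (not_lt.1 h)]
    rfl

@[simp] lemma occupied_append_right (X Y : List Tile) (i : ℕ) :
    occupied (X ++ Y) (size X + i) = occupied Y i := by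
  simp [occupied_append]

lemma occupied_append_tile (X Y : List Tile) {t : Tile} {i : ℕ} (hi : i < t.word.length) :
    occupied (X ++ t :: Y) (size X + i) = t.word.getD i false := by
  rw [occupied_append_right, occupied, conf_cons, List.getD_append _ _ _ _ hi]

/-- Bulk tilings of the sites `0, …, L + 3` whose first site and last three sites are empty. They
encode the BVMD tilings of `[1, L]` without boundary tiles: the void on the left turns `Bl` into
`D`, the voids on the right turn `M1`, `M2`, `D1`, `D2`, `Br` into `MV`, `MVV`, `DV`, `DVV`, `D`. -/
structure IsPadded (L : ℕ) (T : List Tile) : Prop where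
  bulk : ∀ t ∈ T, t.IsBulk
  size_eq : size T = L + 4
  left : occupied T 0 = false
  right : ∀ i, L < i → occupied T i = false

/-- The configuration of the sites `1, …, L` of a padded tiling. -/
def cfg (L : ℕ) (T : List Tile) : Config L := fun i => occupied T (i + 1)

lemma IsPadded.conf_eq {L : ℕ} {T : List Tile} (hT : IsPadded L T) :
    conf T = false :: List.ofFn (cfg L T) ++ [false, false, false] := by
  have hlen : (conf T).length = L + 4 := hT.size_eq
  refine List.ext_getElem (by simp [hlen]) fun i h1 h2 => ?_
  have hi : (conf T)[i] = occupied T i := (List.getD_eq_getElem _ _ h1).symm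
  rw [hi]
  rcases i with _ | i
  · exact hT.left
  · rcases lt_or_ge i L with hiL | hiL
    · simp [hiL, cfg]
    · obtain ⟨j, rfl⟩ := Nat.exists_eq_add_of_le hiL
      rw [hT.right _ (by omega)]
      obtain rfl | rfl | rfl : j = 0 ∨ j = 1 ∨ j = 2 := by omega
      all_goals simp

lemma conf_ne_true_true {T : List Tile} (hT : ∀ t ∈ T, t.IsBulk) (w : List Bool) :
    conf T ≠ true :: true :: w := by
  rcases T with _ | ⟨t, T⟩
  · simp
  · obtain rfl | rfl | rfl := hT t List.mem_cons_self <;> simp [Tile.word]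

lemma conf_injOn_bulk {T T' : List Tile} (hT : ∀ t ∈ T, t.IsBulk) (hT' : ∀ t ∈ T', t.IsBulk)
    (h : conf T = conf T') : T = T' := by
  induction T generalizing T' with
  | nil =>
    rcases T' with _ | ⟨t', T'⟩
    · rfl
    · exact absurd (congrArg List.length h) (size_pos (List.cons_ne_nil t' T')).ne
  | cons t T ih =>
    rcases T' with _ | ⟨t', T'⟩
    · exact absurd (congrArg List.length h) (size_pos (List.cons_ne_nil t T)).ne'
    obtain ⟨ht, hbulk⟩ := List.forall_mem_cons.1 hT
    obtain ⟨ht', hbulk'⟩ := List.forall_mem_cons.1 hT'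
    have htt' : t = t' := by
      rw [conf_cons, conf_cons] at h
      obtain rfl | rfl | rfl := ht <;> obtain rfl | rfl | rfl := ht' <;>
        simp only [Tile.word, List.cons_append, List.cons.injEq, List.nil_append, true_and,
          Bool.false_eq_true, Bool.true_eq_false, false_and] at h ⊢
      · exact absurd h (conf_ne_true_true hbulk _)
      · exact absurd h.symm (conf_ne_true_true hbulk' _)
    subst htt'
    rw [ih hbulk hbulk' (List.append_cancel_left h)]

lemma IsPadded.cfg_injective {L : ℕ} {T T' : List Tile} (hT : IsPadded L T)
    (hT' : IsPadded L T') (h : cfg L T = cfg L T') : T = T' :=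
  conf_injOn_bulk hT.bulk hT'.bulk (by rw [hT.conf_eq, hT'.conf_eq, h])

lemma IsPadded.append {L : ℕ} {X R R' Y : List Tile} (hT : IsPadded L (X ++ (R ++ Y)))
    (hX : 0 < size X) (hR' : ∀ t ∈ R', t.IsBulk) (hsize : size R' = size R)
    (hright : ∀ i, L < size X + i → occupied R' i = false) : IsPadded L (X ++ (R' ++ Y)) where
  bulk := by
    have := hT.bulk
    simp only [List.forall_mem_append] at this ⊢
    exact ⟨this.1, hR', this.2.2⟩
  size_eq := by
    have := hT.size_eq
    simp only [size_append] at this ⊢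
    omega
  left := by
    have := hT.left
    rwa [occupied_append, if_pos hX] at this ⊢
  right i hi := by
    have := hT.right i hi
    rw [occupied_append] at this ⊢
    split_ifs at this ⊢ with hiX
    · exact this
    rw [occupied_append, hsize]
    rw [occupied_append] at this
    split_ifs at this ⊢ with hiR
    · exact hright _ (by omega)
    · exact this

lemma exists_tile_at {T : List Tile} {i : ℕ} (hi : i < size T) :
    ∃ X t Y, T = X ++ t :: Y ∧ size X ≤ i ∧ i < size X + t.word.length := by
  induction T generalizing i with
  | nil => simp at hi
  | cons t T ih =>
    rw [size_cons] at hi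
    rcases lt_or_ge i t.word.length with hit | hit
    · exact ⟨[], t, T, rfl, by simp, by simpa using hit⟩
    · obtain ⟨X, t', Y, rfl, h1, h2⟩ := ih (i := i - t.word.length) (by omega)
      exact ⟨t :: X, t', Y, rfl, by rw [size_cons]; omega, by rw [size_cons]; omega⟩

lemma lt_size_of_occupied {T : List Tile} {i : ℕ} (h : occupied T i = true) : i < size T := by
  by_contra hi
  rw [occupied, List.getD_eq_default _ _ (not_lt.1 hi)] at h
  exact Bool.false_ne_true h

section Patterns

variable {T : List Tile} (hT : ∀ t ∈ T, t.IsBulk) {i : ℕ}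
include hT

lemma exists_tile_of_occupied (hi : occupied T i = true) :
    ∃ X Y, T = X ++ .M :: Y ∧ i = size X ∨
      T = X ++ .D :: Y ∧ (i = size X + 1 ∨ i = size X + 2) := by
  obtain ⟨X, t, Y, rfl, h1, h2⟩ := exists_tile_at (lt_size_of_occupied hi)
  obtain ⟨j, rfl⟩ := Nat.exists_eq_add_of_le h1
  have hj : j < t.word.length := by omega
  rw [occupied_append_tile X Y hj] at hi
  refine ⟨X, Y, ?_⟩
  obtain rfl | rfl | rfl := hT t (by simp) <;>
    simp only [Tile.word, List.length_cons, List.length_nil] at hj <;>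
    interval_cases j <;> simp_all [Tile.word]

lemma exists_dimer_of_occupied (hi : occupied T i = true) (hi' : occupied T (i + 1) = true) :
    ∃ X Y, T = X ++ .D :: Y ∧ i = size X + 1 := by
  obtain ⟨X, Y, ⟨rfl, rfl⟩ | ⟨rfl, rfl | rfl⟩⟩ := exists_tile_of_occupied hT hi
  · rw [occupied_append_tile X Y (by simp [Tile.word])] at hi'
    simp [Tile.word] at hi'
  · exact ⟨X, Y, rfl, rfl⟩
  · rw [add_assoc, occupied_append_tile X Y (by simp [Tile.word])] at hi'
    simp [Tile.word] at hi'

lemma exists_monomers_of_occupied (hi : occupied T i = true) (hi' : occupied T (i + 3) = true) :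
    ∃ X Y, T = X ++ .M :: .M :: Y ∧ i = size X := by
  obtain ⟨X, Y, ⟨rfl, rfl⟩ | ⟨rfl, rfl | rfl⟩⟩ := exists_tile_of_occupied hT hi
  · rcases Y with _ | ⟨t, Y⟩
    · rw [occupied_append_right] at hi'
      simp [occupied, Tile.word] at hi'
    · rw [occupied_append_right] at hi'
      obtain rfl | rfl | rfl := hT t (by simp)
      · simp [occupied, Tile.word] at hi'
      · exact ⟨X, Y, rfl, rfl⟩
      · simp [occupied, Tile.word] at hi'
  all_goals
    rw [add_assoc, occupied_append_tile X Y (by simp [Tile.word])] at hi'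
    simp [Tile.word] at hi'

lemma not_occupied_two_apart (hi : occupied T i = true) : occupied T (i + 2) = false := by
  obtain ⟨X, Y, ⟨rfl, rfl⟩ | ⟨rfl, rfl | rfl⟩⟩ := exists_tile_of_occupied hT hi
  · rw [occupied_append_tile X Y (by simp [Tile.word])]
    rfl
  all_goals
    rw [add_assoc, occupied_append_tile X Y (by simp [Tile.word])]
    rfl

end Patterns

lemma IsPadded.of_conf_eq {L : ℕ} {T : List Tile} {w : List Bool} (hT : ∀ t ∈ T, t.IsBulk)
    (hw : w.length = L) (h : conf T = false :: w ++ [false, false, false]) : IsPadded L T where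
  bulk := hT
  size_eq := by simp [size, h, hw]
  left := by simp [occupied, h]
  right i hi := by
    obtain ⟨j, rfl⟩ : ∃ j, i = j + L + 1 := ⟨i - (L + 1), by omega⟩
    rw [occupied, h, List.cons_append, List.getD_cons_succ,
      List.getD_append_right _ _ _ _ (by omega)]
    rcases j with _ | _ | _ | j <;> simp [hw]

lemma cfg_eq_getD {L : ℕ} {T : List Tile} {w : List Bool} (hw : w.length = L)
    (h : conf T = false :: w ++ [false, false, false]) :
    cfg L T = fun i : Fin L => w.getD i false := by
  funext i
  rw [cfg, occupied, h, List.cons_append, List.getD_cons_succ,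
    List.getD_append _ _ _ _ (by omega)]

/-- The bulk tiles covering the sites of a tile that may stand last in a BVMD tiling, other than
`Bl`, and the three empty sites to its right. -/
def Tile.padRight : Tile → List Tile
  | .M1 => [.M, .V]
  | .M2 => [.M, .V, .V]
  | .D1 => [.D, .V]
  | .D2 => [.D, .V, .V]
  | .Br => [.D]
  | t => [t, .V, .V, .V]

lemma Tile.conf_padRight (t : Tile) : conf t.padRight = t.word ++ [false, false, false] := by
  cases t <;> rfl

lemma Tile.isBulk_of_mem_padRight {t : Tile} (ht : t ≠ .Bl) : ∀ s ∈ t.padRight, s.IsBulk := by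
  cases t <;> simp_all [padRight, IsBulk]

lemma IsBVMD.exists_isPadded {L : ℕ} {T : List Tile} (hT : IsBVMD L T) :
    ∃ P, IsPadded L P ∧ conf P = false :: conf T ++ [false, false, false] := by
  suffices h : ∃ P, (∀ t ∈ P, t.IsBulk) ∧ conf P = false :: conf T ++ [false, false, false] by
    obtain ⟨P, hbulk, hconf⟩ := h
    exact ⟨P, .of_conf_eq hbulk hT.covers hconf, hconf⟩
  obtain ⟨P, t, ht, hP, hPT⟩ : ∃ P t, t ≠ Tile.Bl ∧ (∀ s ∈ P, s.IsBulk) ∧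
      conf (P ++ [t]) = false :: conf T := by
    rcases T.eq_nil_or_concat with rfl | ⟨S, t, rfl⟩
    · exact ⟨[], .V, by simp, by simp, rfl⟩
    have hS : ∀ s ∈ S, s ≠ .Bl → s.IsBulk := fun s hs hsB => by
      simpa [Tile.IsBulk, hsB] using hT.right s (by simpa using hs)
    rcases S with _ | ⟨s, S⟩
    · rcases eq_or_ne t .Bl with rfl | ht
      · exact ⟨[], .D, by simp, by simp, rfl⟩
      · exact ⟨[.V], t, ht, by simp [Tile.IsBulk], rfl⟩
    · have hleft : Tile.Bl ∉ S ∧ Tile.Bl ≠ t := by simpa using hT.left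
      have hS' : ∀ s ∈ S, s.IsBulk := fun s hs =>
        hS s (List.mem_cons_of_mem _ hs) (by rintro rfl; exact hleft.1 hs)
      rcases eq_or_ne s .Bl with rfl | hs
      · exact ⟨.D :: S, t, hleft.2.symm, by simpa [Tile.IsBulk] using hS', by simp [Tile.word]⟩
      · refine ⟨.V :: s :: S, t, hleft.2.symm, ?_, by simp [Tile.word]⟩
        simpa [Tile.IsBulk] using ⟨hS s (by simp) hs, hS'⟩
  refine ⟨P ++ t.padRight, ?_, ?_⟩
  · exact List.forall_mem_append.2 ⟨hP, Tile.isBulk_of_mem_padRight ht⟩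
  · rw [conf_append, Tile.conf_padRight, ← hPT, conf_append, ← List.append_assoc]
    simp

lemma exists_conf_eq_of_conf_eq_append {S : List Tile} {w : List Bool} (hS : ∀ t ∈ S, t.IsBulk)
    (h : conf S = w ++ [false, false, false]) :
    ∃ T, conf T = w ∧ (∀ t ∈ T.dropLast, t.IsBulk) ∧ Tile.Bl ∉ T := by
  have no_Bl {U : List Tile} (hU : ∀ t ∈ U, t.IsBulk) : Tile.Bl ∉ U := fun hB => by
    simpa [Tile.IsBulk] using hU _ hB
  have close {U : List Tile} (hU : ∀ t ∈ U, t.IsBulk) (t : Tile) (ht : t ≠ .Bl)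
      (hconf : (conf U ++ t.word).reverse = w.reverse) :
      ∃ T, conf T = w ∧ (∀ t ∈ T.dropLast, t.IsBulk) ∧ Tile.Bl ∉ T :=
    ⟨U ++ [t], by simpa using List.reverse_injective hconf, by simpa using hU,
      by simpa [no_Bl hU] using ht.symm⟩
  have h_rev := congrArg List.reverse h
  rcases S.eq_nil_or_concat' with rfl | ⟨S, t, rfl⟩
  · simp at h_rev
  simp only [List.forall_mem_append, List.forall_mem_singleton] at hS
  obtain ⟨hS, rfl | rfl | rfl⟩ := hS
  rotate_left
  · simp [Tile.word] at h_rev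
  · exact close hS .Br (by simp) (by simpa [Tile.word] using h_rev)
  rcases S.eq_nil_or_concat' with rfl | ⟨S, t, rfl⟩
  · simp [Tile.word] at h_rev
  simp only [List.forall_mem_append, List.forall_mem_singleton] at hS
  obtain ⟨hS, rfl | rfl | rfl⟩ := hS
  rotate_left
  · exact close hS .M1 (by simp) (by simpa [Tile.word] using h_rev)
  · exact close hS .D1 (by simp) (by simpa [Tile.word] using h_rev)
  rcases S.eq_nil_or_concat' with rfl | ⟨S, t, rfl⟩
  · simp [Tile.word] at h_rev
  simp only [List.forall_mem_append, List.forall_mem_singleton] at hS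
  obtain ⟨hS, rfl | rfl | rfl⟩ := hS
  · refine ⟨S, List.reverse_injective (by simpa [Tile.word] using h_rev), ?_, no_Bl hS⟩
    exact fun t ht => hS t (List.mem_of_mem_dropLast ht)
  · exact close hS .M2 (by simp) (by simpa [Tile.word] using h_rev)
  · exact close hS .D2 (by simp) (by simpa [Tile.word] using h_rev)

lemma IsPadded.exists_isBVMD {L : ℕ} {P : List Tile} (hL : 5 ≤ L) (hP : IsPadded L P) :
    ∃ T, IsBVMD L T ∧ conf P = false :: conf T ++ [false, false, false] := by
  obtain ⟨B, S, hB, hS, hPS⟩ : ∃ B S, (B = [] ∨ B = [Tile.Bl]) ∧ (∀ t ∈ S, t.IsBulk) ∧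
      conf P = false :: (conf B ++ conf S) := by
    have hleft := hP.left
    rcases P with _ | ⟨t, S⟩
    · simpa using hP.size_eq
    obtain ⟨rfl | rfl | rfl, hS⟩ := List.forall_mem_cons.1 hP.bulk
    · exact ⟨[], S, .inl rfl, hS, rfl⟩
    · simp [occupied, Tile.word] at hleft
    · exact ⟨[.Bl], S, .inr rfl, hS, rfl⟩
  have hBlen : (conf B).length ≤ 5 := by rcases hB with rfl | rfl <;> simp [Tile.word]
  have hw := hP.conf_eq
  set w := List.ofFn (cfg L P)
  have hwlen : w.length = L := List.length_ofFn
  obtain ⟨v, hwv, hSv⟩ : ∃ v, w = conf B ++ v ∧ conf S = v ++ [false, false, false] := by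
    rw [hPS, List.cons_append, List.cons.injEq, List.append_eq_append_iff] at hw
    obtain ⟨-, h | ⟨v, hBv, hv⟩⟩ := hw
    · exact h
    · obtain rfl : v = [] := List.length_eq_zero_iff.1 (by
        have := congrArg List.length hBv
        rw [List.length_append] at this
        omega)
      exact ⟨[], by simpa using hBv.symm, hv.symm⟩
  obtain ⟨T, rfl, hbulk, hBl⟩ := exists_conf_eq_of_conf_eq_append hS hSv
  refine ⟨B ++ T, ⟨by rw [conf_append, ← hwv, hwlen], ?_, ?_⟩, by simp [hPS, hSv]⟩
  · rcases hB with rfl | rfl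
    · exact fun h => hBl (List.mem_of_mem_tail h)
    · exact hBl
  · have of_bulk : ∀ t ∈ T.dropLast, t = .V ∨ t = .M ∨ t = .D ∨ t = .Bl := fun t ht => by
      obtain h | h | h := hbulk t ht <;> simp [h]
    rcases hB with rfl | rfl
    · exact of_bulk
    · rcases T with _ | ⟨t, T⟩
      · simp
      · simpa using of_bulk

/-! ### The tiling space -/

lemma mem_tilingSpace_iff {L : ℕ} (hL : 5 ≤ L) {ψ : Hilb L} :
    ψ ∈ tilingSpace L ↔ ∀ μ, ψ μ ≠ 0 → ∃ T, IsPadded L T ∧ cfg L T = μ := by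
  constructor
  · intro h
    induction h using Submodule.span_induction with
    | mem v hv =>
      obtain ⟨T, hT, rfl⟩ := hv
      obtain ⟨P, hP, hconf⟩ := hT.exists_isPadded
      intro μ hμ
      refine ⟨P, hP, ?_⟩
      rw [cfg_eq_getD hT.covers hconf]
      by_contra hne
      exact hμ (by rw [ket, PiLp.single_apply, if_neg (Ne.symm hne)])
    | zero => exact fun μ hμ => absurd rfl hμ
    | add v w _ _ hv hw =>
      intro μ hμ
      by_cases hvμ : v μ = 0
      · exact hw μ (by simpa [hvμ] using hμ)
      · exact hv μ hvμ
    | smul c v _ hv => exact fun μ hμ => hv μ (right_ne_zero_of_mul hμ)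
  · intro h
    rw [← (EuclideanSpace.basisFun (Config L) ℂ).sum_repr ψ]
    refine Submodule.sum_mem _ fun μ _ => ?_
    rw [EuclideanSpace.basisFun_repr, EuclideanSpace.basisFun_apply]
    by_cases hμ : ψ μ = 0
    · rw [hμ, zero_smul]
      exact zero_mem _
    obtain ⟨P, hP, rfl⟩ := h μ hμ
    obtain ⟨T, hT, hconf⟩ := hP.exists_isBVMD hL
    refine Submodule.smul_mem _ _ (Submodule.subset_span ⟨T, hT, ?_⟩)
    rw [ket, cfg_eq_getD hT.covers hconf]

lemma setPair_setPair (i j : Fin L) (c d : Bool) (μ : Config L) :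
    setPair i j c (setPair i j d μ) = setPair i j c μ := by
  funext m
  by_cases hj : m = j <;> by_cases hi : m = i <;> simp [setPair, Function.update_apply, hi, hj]

lemma setPair_eq_self {i j : Fin L} {c : Bool} {μ : Config L} (hi : μ i = c) (hj : μ j = c) :
    setPair i j c μ = μ := by
  rw [setPair, ← hi, Function.update_eq_self, hi, ← hj, Function.update_eq_self]

lemma setPair_apply_left {i j : Fin L} (c : Bool) (μ : Config L) : setPair i j c μ i = c := by
  by_cases h : i = j <;> simp [setPair, h]

lemma setPair_apply_right {i j : Fin L} (c : Bool) (μ : Config L) : setPair i j c μ j = c := by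
  simp [setPair]

lemma setPair_cfg {X R R' Y : List Tile} {i j : ℕ} {hi : i < L} {hj : j < L} {c : Bool}
    (hsize : size R' = size R)
    (h : ∀ k < size R, occupied R' k =
      if size X + k = i + 1 ∨ size X + k = j + 1 then c else occupied R k)
    (hiR : size X ≤ i + 1 ∧ i + 1 < size X + size R)
    (hjR : size X ≤ j + 1 ∧ j + 1 < size X + size R) :
    setPair ⟨i, hi⟩ ⟨j, hj⟩ c (cfg L (X ++ (R ++ Y))) = cfg L (X ++ (R' ++ Y)) := by
  funext ⟨m, hm⟩
  simp only [setPair, cfg, Function.update_apply, Fin.mk.injEq, occupied_append, hsize]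
  rcases lt_or_ge (m + 1) (size X) with hX | hX
  · rw [if_neg (by omega), if_neg (by omega), if_pos hX, if_pos hX]
  obtain ⟨k, hk⟩ := Nat.exists_eq_add_of_le hX
  rw [if_neg hX.not_gt, if_neg hX.not_gt, show m + 1 - size X = k by omega]
  rcases lt_or_ge k (size R) with hR | hR
  · rw [if_pos hR, if_pos hR, h k hR, ite_or]
    simp only [← hk, add_left_inj]
    split_ifs <;> rfl
  · rw [if_neg (by omega), if_neg (by omega), if_neg hR.not_gt, if_neg hR.not_gt]

/-- Six voids, standing in place of a dimer or of two monomers: the bond operator `q_x` maps the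
configurations of both to this one. -/
def sixVoids : List Tile := List.replicate 6 .V

section Bond

variable {x : ℕ} (h1 : 1 ≤ x) (h2 : x + 3 ≤ L)
include h1 h2

lemma isPadded_monomers_iff {X Y : List Tile} (hX : size X = x) :
    IsPadded L (X ++ .M :: .M :: Y) ↔ IsPadded L (X ++ .D :: Y) := by
  have tail_empty (i : ℕ) (hi : L < size X + i) :
      occupied [.M, .M] i = false ∧ occupied [.D] i = false := by
    obtain ⟨j, rfl⟩ : ∃ j, i = j + 4 := ⟨i - 4, by omega⟩
    rcases j with _ | _ | j <;> exact ⟨rfl, rfl⟩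
  constructor <;> intro h
  · exact IsPadded.append (R := [.M, .M]) (R' := [.D]) h (by omega) (by simp [Tile.IsBulk])
      rfl fun i hi => (tail_empty i hi).2
  · exact IsPadded.append (R := [.D]) (R' := [.M, .M]) h (by omega) (by simp [Tile.IsBulk])
      rfl fun i hi => (tail_empty i hi).1

omit h1 in
lemma setPair_cfg_dimer {X Y : List Tile} (hX : size X = x) :
    setPair ⟨x, by omega⟩ ⟨x + 1, by omega⟩ false (cfg L (X ++ .D :: Y)) =
        cfg L (X ++ (sixVoids ++ Y)) ∧
      setPair ⟨x, by omega⟩ ⟨x + 1, by omega⟩ true (cfg L (X ++ (sixVoids ++ Y))) =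
        cfg L (X ++ .D :: Y) := by
  have hsize : size [.D] = 6 ∧ size sixVoids = 6 := ⟨rfl, rfl⟩
  constructor
  · refine setPair_cfg (R := [.D]) rfl (fun k (hk : k < 6) => ?_) (by omega) (by omega)
    simp only [hX, add_assoc, add_right_inj]
    interval_cases k <;> rfl
  · refine setPair_cfg (R' := [.D]) rfl (fun k (hk : k < 6) => ?_) (by omega) (by omega)
    simp only [hX, add_assoc, add_right_inj]
    interval_cases k <;> rfl

lemma setPair_cfg_monomers {X Y : List Tile} (hX : size X = x) :
    setPair ⟨x - 1, by omega⟩ ⟨x + 2, by omega⟩ false (cfg L (X ++ .M :: .M :: Y)) =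
        cfg L (X ++ (sixVoids ++ Y)) ∧
      setPair ⟨x - 1, by omega⟩ ⟨x + 2, by omega⟩ true (cfg L (X ++ (sixVoids ++ Y))) =
        cfg L (X ++ .M :: .M :: Y) := by
  have hsize : size [.M, .M] = 6 ∧ size sixVoids = 6 := ⟨rfl, rfl⟩
  have index (k : ℕ) : (size X + k = x - 1 + 1 ↔ k = 0) ∧ (size X + k = x + 2 + 1 ↔ k = 3) := by
    omega
  constructor
  · refine setPair_cfg (R := [.M, .M]) rfl (fun k (hk : k < 6) => ?_) (by omega) (by omega)
    simp only [index]
    interval_cases k <;> rfl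
  · refine setPair_cfg (R' := [.M, .M]) rfl (fun k (hk : k < 6) => ?_) (by omega) (by omega)
    simp only [index]
    interval_cases k <;> rfl

lemma q_apply_sixVoids (lam : ℂ) (ψ : Hilb L) {X Y : List Tile} (hX : size X = x) :
    q L lam x ψ (cfg L (X ++ (sixVoids ++ Y))) =
      ψ (cfg L (X ++ .D :: Y)) - lam * ψ (cfg L (X ++ .M :: .M :: Y)) := by
  have empty (m : Fin L) (hm : size X ≤ m + 1 ∧ m + 1 < size X + 6) :
      cfg L (X ++ (sixVoids ++ Y)) m = false := by
    obtain ⟨k, hk⟩ := Nat.exists_eq_add_of_le hm.1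
    have hk6 : k < 6 := by omega
    rw [cfg, hk, occupied_append_right]
    interval_cases k <;> rfl
  rw [q_apply h1 h2, (setPair_cfg_dimer h2 hX).2, (setPair_cfg_monomers h1 h2 hX).2,
    if_pos ⟨empty _ ⟨by simp; omega, by simp; omega⟩, empty _ ⟨by simp; omega, by simp; omega⟩⟩,
    if_pos ⟨empty _ ⟨by simp; omega, by simp; omega⟩, empty _ ⟨by simp; omega, by simp; omega⟩⟩]

variable (lam : ℂ) (hL : 5 ≤ L) {ψ : Hilb L} (hψ : ψ ∈ tilingSpace L)
include hL hψ

lemma exists_cfg_sixVoids_of_q_apply_ne_zero {μ : Config L} (hμ : q L lam x ψ μ ≠ 0) :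
    ∃ X Y, IsPadded L (X ++ .D :: Y) ∧ size X = x ∧ cfg L (X ++ (sixVoids ++ Y)) = μ := by
  rw [mem_tilingSpace_iff hL] at hψ
  rw [q_apply h1 h2] at hμ
  obtain ⟨⟨hi, hj⟩, hne⟩ | ⟨⟨hi, hj⟩, hne⟩ :
      ((μ ⟨x, by omega⟩ = false ∧ μ ⟨x + 1, by omega⟩ = false) ∧
        ψ (setPair ⟨x, by omega⟩ ⟨x + 1, by omega⟩ true μ) ≠ 0) ∨
      ((μ ⟨x - 1, by omega⟩ = false ∧ μ ⟨x + 2, by omega⟩ = false) ∧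
        ψ (setPair ⟨x - 1, by omega⟩ ⟨x + 2, by omega⟩ true μ) ≠ 0) := by
    contrapose! hμ
    rw [ite_eq_right_iff.2 hμ.1, ite_eq_right_iff.2 hμ.2, mul_zero, sub_zero]
  · obtain ⟨T, hT, hTμ⟩ := hψ _ hne
    obtain ⟨X, Y, rfl, hX⟩ := exists_dimer_of_occupied hT.bulk (i := x + 1)
      ((congrFun hTμ _).trans (setPair_apply_left _ _))
      ((congrFun hTμ _).trans (setPair_apply_right _ _))
    obtain rfl : x = size X := by omega
    refine ⟨X, Y, hT, rfl, ?_⟩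
    rw [← (setPair_cfg_dimer h2 rfl).1, hTμ, setPair_setPair, setPair_eq_self hi hj]
  · obtain ⟨T, hT, hTμ⟩ := hψ _ hne
    have hx : x - 1 + 1 = x := by omega
    obtain ⟨X, Y, rfl, rfl⟩ := exists_monomers_of_occupied hT.bulk (i := x)
      (by simpa only [cfg, hx] using (congrFun hTμ _).trans (setPair_apply_left _ _))
      ((congrFun hTμ _).trans (setPair_apply_right _ _))
    refine ⟨X, Y, (isPadded_monomers_iff h1 h2 rfl).1 hT, rfl, ?_⟩
    rw [← (setPair_cfg_monomers h1 h2 rfl).1, hTμ, setPair_setPair, setPair_eq_self hi hj]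

lemma q_eq_zero_iff :
    q L lam x ψ = 0 ↔ ∀ X Y, IsPadded L (X ++ .D :: Y) → size X = x →
      ψ (cfg L (X ++ .D :: Y)) = lam * ψ (cfg L (X ++ .M :: .M :: Y)) := by
  constructor
  · intro h0 X Y _ hX
    rw [← sub_eq_zero, ← q_apply_sixVoids h1 h2 lam ψ hX, h0]
    rfl
  · intro hrel
    ext μ
    by_contra hμ
    obtain ⟨X, Y, hT, hX, rfl⟩ := exists_cfg_sixVoids_of_q_apply_ne_zero h1 h2 lam hL hψ hμ
    exact hμ (by rw [q_apply_sixVoids h1 h2 lam ψ hX, hrel X Y hT hX, sub_self]; rfl)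

lemma star_q_mul_q_mem_tilingSpace :
    (star (q L lam x) * q L lam x) ψ ∈ tilingSpace L := by
  rw [mem_tilingSpace_iff hL]
  intro μ hμ
  rw [mul_apply_eq_comp, star_q_apply h1 h2] at hμ
  obtain ⟨⟨hi, hj⟩, hne⟩ | ⟨⟨hi, hj⟩, hne⟩ :
      ((μ ⟨x, by omega⟩ = true ∧ μ ⟨x + 1, by omega⟩ = true) ∧
        q L lam x ψ (setPair ⟨x, by omega⟩ ⟨x + 1, by omega⟩ false μ) ≠ 0) ∨
      ((μ ⟨x - 1, by omega⟩ = true ∧ μ ⟨x + 2, by omega⟩ = true) ∧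
        q L lam x ψ (setPair ⟨x - 1, by omega⟩ ⟨x + 2, by omega⟩ false μ) ≠ 0) := by
    contrapose! hμ
    rw [ite_eq_right_iff.2 hμ.1, ite_eq_right_iff.2 hμ.2, mul_zero, sub_zero]
  all_goals obtain ⟨X, Y, hT, hX, hν⟩ :=
    exists_cfg_sixVoids_of_q_apply_ne_zero h1 h2 lam hL hψ hne
  · refine ⟨_, hT, ?_⟩
    rw [← (setPair_cfg_dimer h2 hX).2, hν, setPair_setPair, setPair_eq_self hi hj]
  · refine ⟨_, (isPadded_monomers_iff h1 h2 hX).2 hT, ?_⟩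
    rw [← (setPair_cfg_monomers h1 h2 hX).2, hν, setPair_setPair, setPair_eq_self hi hj]

end Bond

lemma num_mul_num_apply_eq_zero {x : ℕ} (h1 : 1 ≤ x) (h2 : x + 2 ≤ L) (hL : 5 ≤ L) {ψ : Hilb L}
    (hψ : ψ ∈ tilingSpace L) : (num L x * num L (x + 2)) ψ = 0 := by
  ext μ
  rw [mul_apply_eq_comp, num_apply h1 (by omega), num_apply (by omega) h2, ← ite_and]
  refine ite_eq_right_iff.2 fun ⟨hx, hx2⟩ => ?_
  by_contra hμ
  obtain ⟨T, hT, rfl⟩ := (mem_tilingSpace_iff hL).1 hψ μ hμ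
  rw [cfg, show x - 1 + 1 = x by omega] at hx
  have := not_occupied_two_apart hT.bulk hx
  rw [cfg, show x + 2 - 1 + 1 = x + 2 by omega, this] at hx2
  exact Bool.false_ne_true hx2

/-! ### The Hamiltonians on the tiling space -/

/-- The relations between the amplitudes of a kernel vector of the Hamiltonian of `[a, b]`: a
dimer on a bond `[x, x + 3] ⊆ [a, b]` carries `lam` times the amplitude of two monomers. -/
def IsRelated (L : ℕ) (lam : ℂ) (F : List Tile → ℂ) (a b : ℕ) : Prop :=
  ∀ X Y, IsPadded L (X ++ .D :: Y) → a ≤ size X → size X + 3 ≤ b →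
    F (X ++ .D :: Y) = lam * F (X ++ .M :: .M :: Y)

section Ham

variable {a b : ℕ} (κ : ℝ) (lam : ℂ) (hL : 5 ≤ L) (ha : 1 ≤ a) (hab : a + 3 ≤ b) (hb : b ≤ L)
  {ψ : Hilb L} (hψ : ψ ∈ tilingSpace L)
include hL ha hab hb hψ

lemma ham_apply_of_mem_tilingSpace : Ham L κ lam a b ψ =
    (κ : ℂ) • ∑ x ∈ Finset.Icc a (b - 3), (star (q L lam x) * q L lam x) ψ := by
  rw [Ham, add_apply, smul_apply, sum_apply, sum_apply, Finset.sum_eq_zero, zero_add]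
  intro x hx
  rw [Finset.mem_Icc] at hx
  exact num_mul_num_apply_eq_zero (by omega) (by omega) hL hψ

lemma ham_mem_tilingSpace : Ham L κ lam a b ψ ∈ tilingSpace L := by
  rw [ham_apply_of_mem_tilingSpace κ lam hL ha hab hb hψ]
  refine Submodule.smul_mem _ _ (Submodule.sum_mem _ fun x hx => ?_)
  rw [Finset.mem_Icc] at hx
  exact star_q_mul_q_mem_tilingSpace (by omega) (by omega) lam hL hψ

lemma inner_ham_eq_sum : inner ℂ ψ (Ham L κ lam a b ψ) =
    ((κ * ∑ x ∈ Finset.Icc a (b - 3), ‖q L lam x ψ‖ ^ 2 : ℝ) : ℂ) := by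
  rw [ham_apply_of_mem_tilingSpace κ lam hL ha hab hb hψ, inner_smul_right, inner_sum,
    Complex.ofReal_mul, Complex.ofReal_sum]
  congr 1
  refine Finset.sum_congr rfl fun x _ => ?_
  rw [mul_apply_eq_comp, ContinuousLinearMap.star_eq_adjoint,
    ContinuousLinearMap.adjoint_inner_right, inner_self_eq_norm_sq_to_K, Complex.ofReal_pow]
  rfl

lemma ham_eq_zero_iff_isRelated (hκ : 0 < κ) :
    Ham L κ lam a b ψ = 0 ↔ IsRelated L lam (fun T => ψ (cfg L T)) a b := by
  constructor
  · intro h X Y hT h1 h2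
    have energy := inner_ham_eq_sum κ lam hL ha hab hb hψ
    rw [h, inner_zero_right, eq_comm, Complex.ofReal_eq_zero, mul_eq_zero] at energy
    have hq := (Finset.sum_eq_zero_iff_of_nonneg fun x _ => sq_nonneg _).1
      (energy.resolve_left hκ.ne') (size X) (Finset.mem_Icc.2 ⟨h1, by omega⟩)
    rw [sq_eq_zero_iff, norm_eq_zero, q_eq_zero_iff (by omega) (by omega) lam hL hψ] at hq
    exact hq X Y hT rfl
  · intro h
    rw [ham_apply_of_mem_tilingSpace κ lam hL ha hab hb hψ, Finset.sum_eq_zero, smul_zero]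
    intro x hx
    rw [Finset.mem_Icc] at hx
    rw [mul_apply_eq_comp, (q_eq_zero_iff (by omega) (by omega) lam hL hψ).2, map_zero]
    rintro X Y hT rfl
    exact h X Y hT hx.1 (by omega)

end Ham

/-! ### The tilings as an orthogonal basis -/

/-- The padded tilings of `[1, L]`. -/
def tilings (L : ℕ) : Finset (List Tile) :=
  Set.Finite.toFinset (s := {T | IsPadded L T}) <|
    (List.finite_length_le Tile (L + 4)).subset fun T hT =>
      (length_le_length_conf T).trans_eq hT.size_eq

/-- The superposition of the tilings with amplitudes `F`. -/
def tilingVec (L : ℕ) (F : List Tile → ℂ) : Hilb L :=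
  ∑ T ∈ tilings L, F T • EuclideanSpace.single (cfg L T) 1

lemma mem_tilings {T : List Tile} : T ∈ tilings L ↔ IsPadded L T := by
  simp [tilings]

lemma sum_config_eq_sum_tilings {E : Type*} [AddCommMonoid E] {G : Config L → E}
    (hG : ∀ μ, G μ ≠ 0 → ∃ T, IsPadded L T ∧ cfg L T = μ) :
    ∑ μ, G μ = ∑ T ∈ tilings L, G (cfg L T) := by
  rw [← Finset.sum_image (g := cfg L) fun T hT T' hT' h =>
    (mem_tilings.1 hT).cfg_injective (mem_tilings.1 hT') h]
  refine (Finset.sum_subset (Finset.subset_univ _) fun μ _ hμ => ?_).symm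
  by_contra h
  obtain ⟨T, hT, rfl⟩ := hG μ h
  exact hμ (Finset.mem_image_of_mem _ (mem_tilings.2 hT))

lemma inner_eq_sum_tilings (hL : 5 ≤ L) (χ : Hilb L) {ψ : Hilb L} (hψ : ψ ∈ tilingSpace L) :
    inner ℂ χ ψ = ∑ T ∈ tilings L, star (χ (cfg L T)) * ψ (cfg L T) := by
  rw [PiLp.inner_apply]
  simp only [RCLike.inner_apply, mul_comm, starRingEnd_apply]
  exact sum_config_eq_sum_tilings fun μ hμ =>
    (mem_tilingSpace_iff hL).1 hψ μ (right_ne_zero_of_mul hμ)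

lemma norm_sq_eq_sum_tilings (hL : 5 ≤ L) {ψ : Hilb L} (hψ : ψ ∈ tilingSpace L) :
    ‖ψ‖ ^ 2 = ∑ T ∈ tilings L, ‖ψ (cfg L T)‖ ^ 2 := by
  rw [EuclideanSpace.norm_sq_eq]
  exact sum_config_eq_sum_tilings fun μ hμ =>
    (mem_tilingSpace_iff hL).1 hψ μ fun h => hμ (by simp [h])

lemma tilingVec_apply (F : List Tile → ℂ) {T : List Tile} (hT : IsPadded L T) :
    tilingVec L F (cfg L T) = F T := by
  rw [tilingVec, WithLp.ofLp_sum, Finset.sum_apply,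
    Finset.sum_eq_single_of_mem T (mem_tilings.2 hT)]
  · simp
  · intro T' hT' hne
    have hcfg : cfg L T ≠ cfg L T' := fun h =>
      hne (hT.cfg_injective (mem_tilings.1 hT') h).symm
    simp [hcfg]

lemma tilingVec_mem_tilingSpace (hL : 5 ≤ L) (F : List Tile → ℂ) :
    tilingVec L F ∈ tilingSpace L := by
  refine Submodule.sum_mem _ fun T hT => Submodule.smul_mem _ _ ?_
  rw [mem_tilingSpace_iff hL]
  intro μ hμ
  refine ⟨T, mem_tilings.1 hT, ?_⟩
  by_contra h
  exact hμ (by simp [Ne.symm h])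

/-! ### Runs of monomers and dimers -/

/-- The tiles `M`, `D` exchanged by the replacement `MM ↔ D`. -/
def Tile.IsPolymer (t : Tile) : Prop := t = M ∨ t = D

lemma Tile.IsPolymer.isBulk {t : Tile} (ht : t.IsPolymer) : t.IsBulk := Or.inr ht

/-- The tilings by monomers and dimers of an interval that has room for `j` monomers. -/
def runs (j : ℕ) : Finset (List Tile) :=
  Set.Finite.toFinset (s := {R | (∀ t ∈ R, t.IsPolymer) ∧ size R = 3 * j}) <|
    (List.finite_length_le Tile (3 * j)).subset fun R hR =>
      (length_le_length_conf R).trans_eq hR.2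

lemma mem_runs {j : ℕ} {R : List Tile} :
    R ∈ runs j ↔ (∀ t ∈ R, t.IsPolymer) ∧ size R = 3 * j := by
  simp [runs]

lemma append_monomer_mem_runs_iff {j : ℕ} {R : List Tile} :
    R ++ [.M] ∈ runs (j + 1) ↔ R ∈ runs j := by
  simp [mem_runs, or_imp, forall_and, Tile.IsPolymer, Tile.word, mul_add]

lemma append_dimer_mem_runs_iff {j : ℕ} {R : List Tile} :
    R ++ [.D] ∈ runs (j + 2) ↔ R ∈ runs j := by
  simp [mem_runs, or_imp, forall_and, Tile.IsPolymer, Tile.word, mul_add]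

lemma dimer_mem_runs_iff {j : ℕ} {X Y : List Tile} :
    X ++ .D :: Y ∈ runs j ↔ X ++ .M :: .M :: Y ∈ runs j := by
  simp [mem_runs, or_imp, forall_and, Tile.IsPolymer, Tile.word, ← add_assoc]

lemma replicate_mem_runs (j : ℕ) : List.replicate j Tile.M ∈ runs j := by
  induction j with
  | zero => simp [mem_runs]
  | succ j ih => rwa [List.replicate_succ', append_monomer_mem_runs_iff]

lemma runs_zero : runs 0 = {[]} := by
  ext R
  rw [mem_runs, Finset.mem_singleton]
  refine ⟨fun h => ?_, by rintro rfl; simp⟩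
  by_contra hR
  exact (size_pos hR).ne' h.2

lemma eq_concat_of_mem_runs_succ {j : ℕ} {R : List Tile} (hR : R ∈ runs (j + 1)) :
    (∃ S ∈ runs j, S ++ [.M] = R) ∨ ∃ i, j = i + 1 ∧ ∃ S ∈ runs i, S ++ [.D] = R := by
  obtain ⟨htiles, hsize⟩ := mem_runs.1 hR
  obtain rfl | ⟨S, t, rfl⟩ := List.eq_nil_or_concat' R
  · simp at hsize
  obtain rfl | rfl := htiles t (by simp)
  · exact Or.inl ⟨S, append_monomer_mem_runs_iff.1 hR, rfl⟩
  · simp only [size_append, size_cons, size_nil, Tile.word, List.length_cons,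
      List.length_nil] at hsize
    obtain ⟨i, rfl⟩ : ∃ i, j = i + 1 := Nat.exists_eq_add_of_le' (by omega)
    exact Or.inr ⟨i, rfl, S, append_dimer_mem_runs_iff.1 hR, rfl⟩

lemma runs_one : runs 1 = {[.M]} := by
  ext R
  rw [Finset.mem_singleton]
  refine ⟨fun hR => ?_, by rintro rfl; exact replicate_mem_runs 1⟩
  obtain ⟨S, hS, rfl⟩ | ⟨i, hi, -⟩ := eq_concat_of_mem_runs_succ hR
  · rw [runs_zero, Finset.mem_singleton] at hS
    rw [hS, List.nil_append]
  · omega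

lemma sum_runs_add_two {E : Type*} [AddCommMonoid E] (F : List Tile → E) (j : ℕ) :
    ∑ R ∈ runs (j + 2), F R =
      ∑ R ∈ runs (j + 1), F (R ++ [.M]) + ∑ R ∈ runs j, F (R ++ [.D]) := by
  classical
  have hruns : runs (j + 2) = (runs (j + 1)).image (· ++ [.M]) ∪ (runs j).image (· ++ [.D]) := by
    ext R
    rw [Finset.mem_union, Finset.mem_image, Finset.mem_image]
    constructor
    · intro hR
      obtain h | ⟨i, hi, h⟩ := eq_concat_of_mem_runs_succ hR
      · exact Or.inl h
      · obtain rfl : j = i := by omega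
        exact Or.inr h
    · rintro (⟨S, hS, rfl⟩ | ⟨S, hS, rfl⟩)
      · exact append_monomer_mem_runs_iff.2 hS
      · exact append_dimer_mem_runs_iff.2 hS
  rw [hruns, Finset.sum_union, Finset.sum_image, Finset.sum_image]
  · exact fun _ _ _ _ h => List.append_cancel_right h
  · exact fun _ _ _ _ h => List.append_cancel_right h
  · rw [Finset.disjoint_left]
    intro T hT hT'
    obtain ⟨R, -, rfl⟩ := Finset.mem_image.1 hT
    obtain ⟨R', -, h⟩ := Finset.mem_image.1 hT'
    simpa using congrArg List.getLast? h

@[simp] lemma dimerCount_nil : dimerCount [] = 0 := rfl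

@[simp] lemma dimerCount_cons (t : Tile) (T : List Tile) :
    dimerCount (t :: T) = t.dimers + dimerCount T := by
  simp [dimerCount]

@[simp] lemma dimerCount_append (S T : List Tile) :
    dimerCount (S ++ T) = dimerCount S + dimerCount T := by
  simp [dimerCount]

/-! ### The norms of the monomer states -/

/-- The squared norm of `φ_j` as a function of `r = |lam|²`. -/
def runNorm (r : ℝ) : ℕ → ℝ
  | 0 => 1
  | 1 => 1
  | j + 2 => runNorm r (j + 1) + r * runNorm r j

lemma runNorm_pos {r : ℝ} (hr : 0 ≤ r) : ∀ j, 0 < runNorm r j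
  | 0 => one_pos
  | 1 => one_pos
  | j + 2 => add_pos_of_pos_of_nonneg (runNorm_pos hr (j + 1))
      (mul_nonneg hr (runNorm_pos hr j).le)

lemma sum_runs_pow_dimerCount (r : ℝ) (j : ℕ) :
    ∑ R ∈ runs j, r ^ dimerCount R = runNorm r j := by
  induction j using Nat.twoStepInduction with
  | zero => simp [runs_zero, runNorm]
  | one => simp [runs_one, runNorm, Tile.dimers]
  | more j ih ih' =>
    rw [sum_runs_add_two, runNorm, ← ih, ← ih', Finset.mul_sum]
    congr 1 <;> refine Finset.sum_congr rfl fun R _ => ?_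
    · simp [Tile.dimers]
    · simp [Tile.dimers, pow_succ']

lemma betaPlus_sub_betaMinus_mul_runNorm {r : ℝ} (hr : 0 ≤ r) (j : ℕ) :
    (betaPlus r - betaMinus r) * runNorm r j = betaPlus r ^ (j + 1) - betaMinus r ^ (j + 1) := by
  have hs : √(1 + 4 * r) ^ 2 = 1 + 4 * r := Real.sq_sqrt (by positivity)
  have hplus : betaPlus r ^ 2 = betaPlus r + r := by unfold betaPlus; linear_combination hs / 4
  have hminus : betaMinus r ^ 2 = betaMinus r + r := by unfold betaMinus; linear_combination hs / 4
  have hsum : betaPlus r + betaMinus r = 1 := by unfold betaPlus betaMinus; ring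
  induction j using Nat.twoStepInduction with
  | zero => simp [runNorm]
  | one =>
    rw [runNorm]
    linear_combination (-betaPlus r + betaMinus r) * hsum
  | more j ih ih' =>
    rw [runNorm]
    linear_combination ih' + r * ih - betaPlus r ^ (j + 1) * hplus
      + betaMinus r ^ (j + 1) * hminus

lemma beta_succ {r : ℝ} (hr : 0 ≤ r) (n : ℕ) :
    beta r (n + 1) = runNorm r n / runNorm r (n + 1) := by
  have hs : 1 ≤ √(1 + 4 * r) := by
    rw [Real.one_le_sqrt]
    linarith
  have hplus : 0 < betaPlus r := by unfold betaPlus; linarith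
  have hdiff : 0 < betaPlus r - betaMinus r := by unfold betaPlus betaMinus; linarith
  have hpow : betaPlus r ^ (n + 2) - betaMinus r ^ (n + 2) ≠ 0 := by
    have := runNorm_pos hr (n + 1)
    rw [← betaPlus_sub_betaMinus_mul_runNorm hr]
    positivity
  rw [← mul_div_mul_left _ _ hdiff.ne', betaPlus_sub_betaMinus_mul_runNorm hr,
    betaPlus_sub_betaMinus_mul_runNorm hr, beta, div_pow, div_pow, one_sub_div (by positivity),
    one_sub_div (by positivity)]
  field_simp
  ring

lemma connected_cons (t : Tile) {S T : List Tile} (h : Connected S T) :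
    Connected (t :: S) (t :: T) := by
  induction h with
  | rel S T h =>
    refine .rel _ _ ?_
    cases h with
    | bulk A B => exact Replace.bulk (t :: A) B
    | two A => exact Replace.two (t :: A)
    | one A => exact Replace.one (t :: A)
  | refl S => exact .refl _
  | symm S T _ ih => exact .symm _ _ ih
  | trans S T U _ _ ih ih' => exact .trans _ _ _ ih ih'

lemma connected_replicate_of_mem_runs {n : ℕ} {R : List Tile} (hR : R ∈ runs n) :
    Connected R (List.replicate n .M) := by
  rw [mem_runs] at hR
  induction R generalizing n with
  | nil =>
    obtain rfl : n = 0 := by simpa using hR.2.symm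
    exact .refl _
  | cons t R ih =>
    obtain ⟨⟨rfl | rfl, htiles⟩, hsize⟩ := hR.imp_left List.forall_mem_cons.1 <;>
      simp only [size_cons, Tile.word, List.length_cons, List.length_nil] at hsize
    · obtain ⟨m, rfl⟩ : ∃ m, n = m + 1 := Nat.exists_eq_add_of_le' (by omega)
      exact connected_cons _ (ih ⟨htiles, by omega⟩)
    · obtain ⟨m, rfl⟩ : ∃ m, n = m + 2 := Nat.exists_eq_add_of_le' (by omega)
      refine .trans _ _ _ (connected_cons _ (ih (n := m) ⟨htiles, by omega⟩))
        (.symm _ _ (.rel _ _ ?_))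
      exact Replace.bulk [] (List.replicate m .M)

lemma mem_runs_congr_of_connected {S T : List Tile} (h : Connected S T) (n : ℕ) :
    S ∈ runs n ↔ T ∈ runs n := by
  induction h with
  | rel S T h =>
    cases h with
    | bulk A B => simpa using dimer_mem_runs_iff.symm
    | two A | one A => simp [mem_runs, or_imp, forall_and, Tile.IsPolymer]
  | refl S => rfl
  | symm S T _ ih => exact ih.symm
  | trans S T U _ _ ih ih' => exact ih.trans ih'

lemma isBVMD_and_connected_iff_mem_runs {n : ℕ} {T : List Tile} :
    IsBVMD (3 * n) T ∧ Connected T (List.replicate n .M) ↔ T ∈ runs n := by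
  refine ⟨fun h => (mem_runs_congr_of_connected h.2 n).2 (replicate_mem_runs n), fun hT => ?_⟩
  obtain ⟨htiles, hsize⟩ := mem_runs.1 hT
  refine ⟨⟨hsize, fun hB => ?_, fun t ht => ?_⟩, connected_replicate_of_mem_runs hT⟩
  · simpa [Tile.IsPolymer] using htiles _ (List.mem_of_mem_tail hB)
  · obtain h | h := htiles t (List.mem_of_mem_dropLast ht) <;> simp [h]

lemma orthonormal_ket_runs (n : ℕ) :
    Orthonormal ℂ fun R : runs n => ket (3 * n) (conf R.1) := by
  refine ⟨fun R => by simp [ket], fun R S hRS => ?_⟩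
  obtain ⟨htilesR, hsizeR⟩ := mem_runs.1 R.2
  obtain ⟨htilesS, hsizeS⟩ := mem_runs.1 S.2
  simp only [ket]
  rw [EuclideanSpace.inner_single_left, PiLp.single_apply, if_neg, mul_zero]
  refine fun h => hRS (Subtype.ext (conf_injOn_bulk (fun t ht => (htilesR t ht).isBulk)
    (fun t ht => (htilesS t ht).isBulk) (List.ext_getElem (hsizeR.trans hsizeS.symm) ?_)))
  intro i hi hi'
  simpa [hi, hi'] using congrFun h ⟨i, hi.trans_eq hsizeR⟩

lemma norm_phi_sq (lam : ℂ) (n : ℕ) : ‖phi lam n‖ ^ 2 = runNorm (‖lam‖ ^ 2) n := by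
  have hset : (finite_connected (3 * n) (List.replicate n .M)).toFinset = runs n := by
    ext T
    rw [Set.Finite.mem_toFinset]
    exact isBVMD_and_connected_iff_mem_runs
  have hphi : phi lam n = ∑ R : runs n, lam ^ dimerCount R.1 • ket (3 * n) (conf R.1) := by
    rw [phi, bvmdState, hset, ← Finset.sum_coe_sort]
  have hnorm := inner_self_eq_norm_sq_to_K (𝕜 := ℂ) (phi lam n)
  rw [hphi, (orthonormal_ket_runs n).inner_sum, ← hphi] at hnorm
  rw [← sum_runs_pow_dimerCount, ← Finset.sum_coe_sort, ← Complex.ofReal_inj]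
  push_cast
  refine hnorm.symm.trans (Finset.sum_congr rfl fun R _ => ?_)
  rw [map_pow, ← mul_pow, Complex.conj_mul']

lemma norm_phi_sq_div_norm_phi_sq (lam : ℂ) {n : ℕ} (hn : 1 ≤ n) :
    ‖phi lam (n - 1)‖ ^ 2 / ‖phi lam n‖ ^ 2 = beta (‖lam‖ ^ 2) n := by
  obtain ⟨m, rfl⟩ := Nat.exists_eq_add_of_le' hn
  rw [Nat.add_sub_cancel, norm_phi_sq, norm_phi_sq, beta_succ (by positivity)]

/-! ### Properties of `f` -/

lemma beta_pos {r : ℝ} (hr : 0 ≤ r) {n : ℕ} (hn : 1 ≤ n) : 0 < beta r n := by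
  obtain ⟨m, rfl⟩ := Nat.exists_eq_add_of_le' hn
  rw [beta_succ hr]
  exact div_pos (runNorm_pos hr _) (runNorm_pos hr _)

lemma beta_le_one {r : ℝ} (hr : 0 ≤ r) {n : ℕ} (hn : 1 ≤ n) : beta r n ≤ 1 := by
  obtain ⟨m, rfl⟩ := Nat.exists_eq_add_of_le' hn
  rw [beta_succ hr, div_le_one (runNorm_pos hr _)]
  rcases m with _ | m
  · exact le_rfl
  · exact le_add_of_nonneg_right (mul_nonneg hr (runNorm_pos hr m).le)

lemma fk_nonneg {r : ℝ} (hr : 0 ≤ r) {j : ℕ} (hj : 4 ≤ j) : 0 ≤ fk j r := by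
  have := beta_pos hr (n := j) (by omega)
  have := beta_pos hr (n := j - 2) (by omega)
  have := beta_pos hr (n := j - 3) (by omega)
  unfold fk
  positivity

lemma fk_le {r : ℝ} (hr : 0 ≤ r) {j : ℕ} (hj : 4 ≤ j) : fk j r ≤ r * ((1 + r) ^ 2 + r) := by
  have pos0 := beta_pos hr (n := j) (by omega)
  have pos1 := beta_pos hr (n := j - 1) (by omega)
  have := beta_pos hr (n := j - 2) (by omega)
  have pos3 := beta_pos hr (n := j - 3) (by omega)
  have le0 := beta_le_one hr (n := j) (by omega)
  have le1 := beta_le_one hr (n := j - 1) (by omega)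
  have le2 := beta_le_one hr (n := j - 2) (by omega)
  have le3 := beta_le_one hr (n := j - 3) (by omega)
  have prefactor : r * beta r j * beta r (j - 2) ≤ r :=
    mul_le_of_le_one_right (by positivity) le2 |>.trans (mul_le_of_le_one_right hr le0)
  have term1 : (1 - beta r (j - 1) * (1 + r)) ^ 2 / (1 + 2 * r) ≤ (1 + r) ^ 2 := by
    refine (div_le_self (sq_nonneg _) (by linarith)).trans (sq_le_sq' ?_ ?_)
    · nlinarith
    · nlinarith
  have term2 : beta r (j - 3) * (r * (1 - beta r (j - 1)) ^ 2 / (1 + r)) ≤ r := by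
    refine (mul_le_of_le_one_left (by positivity) le3).trans
      ((div_le_self (by positivity) (by linarith)).trans (mul_le_of_le_one_right hr ?_))
    exact pow_le_one₀ (by linarith) (by linarith)
  exact mul_le_mul prefactor (add_le_add term1 term2) (by positivity) hr

lemma bddAbove_fk {r : ℝ} (hr : 0 ≤ r) : BddAbove ((fun j => fk j r) '' Set.Ici 4) := by
  refine ⟨r * ((1 + r) ^ 2 + r), ?_⟩
  rintro _ ⟨j, hj, rfl⟩
  exact fk_le hr hj

lemma fk_le_f {r : ℝ} (hr : 0 ≤ r) {j : ℕ} (hj : 4 ≤ j) : fk j r ≤ f r :=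
  le_csSup (bddAbove_fk hr) ⟨j, hj, rfl⟩

lemma f_nonneg {r : ℝ} (hr : 0 ≤ r) : 0 ≤ f r := (fk_nonneg hr le_rfl).trans (fk_le_f hr le_rfl)

lemma fk_mul_runNorm {r : ℝ} (hr : 0 ≤ r) (i : ℕ) :
    fk (i + 4) r * (runNorm r (i + 2) * runNorm r (i + 4) / runNorm r (i + 3)) =
      r * (1 - runNorm r (i + 2) / runNorm r (i + 3) * (1 + r)) ^ 2 * runNorm r (i + 1)
          / (1 + 2 * r)
        + r ^ 2 * (1 - runNorm r (i + 2) / runNorm r (i + 3)) ^ 2 * runNorm r i / (1 + r) := by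
  have := runNorm_pos hr i
  have pos1 := runNorm_pos hr (i + 1)
  have pos2 := runNorm_pos hr (i + 2)
  have pos3 := runNorm_pos hr (i + 3)
  have pos4 := runNorm_pos hr (i + 4)
  simp only [fk, show i + 4 - 2 = i + 1 + 1 by omega, show i + 4 - 1 = i + 2 + 1 by omega,
    show i + 4 - 3 = i + 1 by omega, beta_succ hr]
  field_simp

/-! ### The estimate on a single run -/

section SingleRun

variable {lam : ℂ}

lemma eq_replicate_of_dimer_notMem {j : ℕ} {R : List Tile} (hR : R ∈ runs j) (hD : .D ∉ R) :
    R = List.replicate j .M := by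
  obtain ⟨htiles, hsize⟩ := mem_runs.1 hR
  have hrep : R = List.replicate R.length .M :=
    List.eq_replicate_of_mem fun t ht => (htiles t ht).resolve_right fun h => hD (h ▸ ht)
  have hlen := (mem_runs.1 (replicate_mem_runs R.length)).2
  rw [← hrep, hsize] at hlen
  rw [hrep, show j = R.length by omega]

lemma eq_pow_dimerCount_mul {g : List Tile → ℂ} {j : ℕ}
    (hg : ∀ X Y, X ++ .D :: Y ∈ runs j → g (X ++ .D :: Y) = lam * g (X ++ .M :: .M :: Y))
    {R : List Tile} (hR : R ∈ runs j) :
    g R = lam ^ dimerCount R * g (List.replicate j .M) := by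
  induction hd : dimerCount R using Nat.strong_induction_on generalizing R with
  | _ d ih =>
    by_cases hD : .D ∈ R
    · obtain ⟨X, Y, rfl⟩ := List.append_of_mem hD
      simp only [dimerCount_append, dimerCount_cons, Tile.dimers] at hd
      rw [hg X Y hR, ih (d - 1) (by omega) (dimer_mem_runs_iff.1 hR) (by simp [Tile.dimers]; omega),
        ← mul_assoc, ← pow_succ', show d - 1 + 1 = d by omega]
    · have hrep := eq_replicate_of_dimer_notMem hR hD
      have hcount : dimerCount R = 0 := by rw [hrep]; simp [dimerCount, Tile.dimers]
      rw [← hd, hcount, pow_zero, one_mul, ← hrep]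

lemma sum_runs_add_four {E : Type*} [AddCommMonoid E] (F : List Tile → E) (i : ℕ) :
    ∑ R ∈ runs (i + 4), F R =
      ∑ R ∈ runs (i + 1), (F (R ++ [.M, .M, .M]) + F (R ++ [.D, .M]) + F (R ++ [.M, .D]))
        + ∑ R ∈ runs i, (F (R ++ [.D, .M, .M]) + F (R ++ [.D, .D])) := by
  simp only [sum_runs_add_two, Finset.sum_add_distrib, List.append_assoc, List.cons_append,
    List.nil_append]
  ac_rfl

lemma norm_sum_star_mul_pow_sq_le (lam : ℂ) (w : List Tile → ℂ) (j : ℕ) :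
    ‖∑ R ∈ runs j, star (w R) * lam ^ dimerCount R‖ ^ 2
      ≤ runNorm (‖lam‖ ^ 2) j * ∑ R ∈ runs j, ‖w R‖ ^ 2 := by
  rw [← sum_runs_pow_dimerCount, mul_comm]
  refine (pow_le_pow_left₀ (norm_nonneg _) (norm_sum_le _ _) 2).trans
    (Finset.sum_sq_le_sum_mul_sum_of_sq_le_mul _ (fun _ _ => by positivity)
      (fun _ _ => by positivity) fun R _ => ?_)
  rw [norm_mul, norm_star, norm_pow, mul_pow, pow_right_comm]

lemma mul_add_mul_sq_le {p x s A Y p' x' s' A' Y' : ℝ} (hs : 0 < s) (hs' : 0 < s')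
    (hA : 0 ≤ A) (hA' : 0 ≤ A') (hY : 0 ≤ Y) (hY' : 0 ≤ Y')
    (h : x ^ 2 ≤ A * Y) (h' : x' ^ 2 ≤ A' * Y') :
    (p * x + p' * x') ^ 2 ≤ (p ^ 2 * A / s + p' ^ 2 * A' / s') * (s * Y + s' * Y') := by
  have cauchy := Finset.sum_sq_le_sum_mul_sum_of_sq_le_mul (Finset.univ : Finset (Fin 2))
    (r := ![p * x, p' * x']) (f := ![p ^ 2 * A / s, p' ^ 2 * A' / s']) (g := ![s * Y, s' * Y'])
  simp only [Finset.mem_univ, forall_const, Fin.forall_fin_two, Fin.sum_univ_two,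
    Matrix.cons_val_zero, Matrix.cons_val_one] at cauchy
  refine cauchy (by constructor <;> positivity) (by constructor <;> positivity) ⟨?_, ?_⟩
  · rw [mul_pow, div_mul_eq_mul_div, mul_left_comm, mul_div_cancel_left₀ _ hs.ne', mul_assoc]
    gcongr
  · rw [mul_pow, div_mul_eq_mul_div, mul_left_comm, mul_div_cancel_left₀ _ hs'.ne', mul_assoc]
    gcongr

section GroundState

variable {i : ℕ} {w : List Tile → ℂ}
  (hw : ∀ X Y, X ++ .D :: Y ∈ runs (i + 4) → 3 * (i + 1) ≤ size X →
    w (X ++ .D :: Y) = lam * w (X ++ .M :: .M :: Y))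
include hw

lemma eq_of_relations_of_mem_runs_succ {R : List Tile} (hR : R ∈ runs (i + 1)) :
    w (R ++ [.D, .M]) = lam * w (R ++ [.M, .M, .M]) ∧
      w (R ++ [.M, .D]) = lam * w (R ++ [.M, .M, .M]) := by
  have hRM : R ++ [.M] ∈ runs (i + 2) := append_monomer_mem_runs_iff.2 hR
  have hsize := (mem_runs.1 hR).2
  refine ⟨hw R [.M] ?_ (by omega), ?_⟩
  · have := append_monomer_mem_runs_iff.2 (append_dimer_mem_runs_iff.2 hR)
    simpa using this
  · have := hw (R ++ [.M]) [] (append_dimer_mem_runs_iff.2 hRM) (by rw [size_append]; omega)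
    simpa using this

lemma eq_of_relations_of_mem_runs {R : List Tile} (hR : R ∈ runs i) :
    w (R ++ [.D, .D]) = lam * w (R ++ [.D, .M, .M]) := by
  have hRD : R ++ [.D] ∈ runs (i + 2) := append_dimer_mem_runs_iff.2 hR
  have hsize := (mem_runs.1 hRD).2
  have := hw (R ++ [.D]) [] (append_dimer_mem_runs_iff.2 hRD) (by omega)
  simpa using this

lemma sum_norm_sq_of_relations : ∑ R ∈ runs (i + 4), ‖w R‖ ^ 2 =
    (1 + 2 * ‖lam‖ ^ 2) * ∑ R ∈ runs (i + 1), ‖w (R ++ [.M, .M, .M])‖ ^ 2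
      + (1 + ‖lam‖ ^ 2) * ∑ R ∈ runs i, ‖w (R ++ [.D, .M, .M])‖ ^ 2 := by
  rw [sum_runs_add_four, Finset.mul_sum, Finset.mul_sum]
  congr 1 <;> refine Finset.sum_congr rfl fun R hR => ?_
  · obtain ⟨hDM, hMD⟩ := eq_of_relations_of_mem_runs_succ hw hR
    rw [hDM, hMD, norm_mul, mul_pow]
    ring
  · rw [eq_of_relations_of_mem_runs hw hR, norm_mul, mul_pow]
    ring

end GroundState

section ExcitedState

variable {j : ℕ} {u : List Tile → ℂ} {a c : ℂ}
  (hM : ∀ R ∈ runs (j + 1), u (R ++ [.M]) = lam ^ dimerCount R * a)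
  (hD : ∀ R ∈ runs j, u (R ++ [.D]) = lam ^ dimerCount R * c)
include hM hD

lemma sum_norm_sq_of_amplitudes : ∑ R ∈ runs (j + 2), ‖u R‖ ^ 2 =
    runNorm (‖lam‖ ^ 2) (j + 1) * ‖a‖ ^ 2 + runNorm (‖lam‖ ^ 2) j * ‖c‖ ^ 2 := by
  rw [sum_runs_add_two, ← sum_runs_pow_dimerCount, ← sum_runs_pow_dimerCount, Finset.sum_mul,
    Finset.sum_mul]
  congr 1 <;> refine Finset.sum_congr rfl fun R hR => ?_
  · rw [hM R hR, norm_mul, norm_pow, mul_pow, pow_right_comm]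
  · rw [hD R hR, norm_mul, norm_pow, mul_pow, pow_right_comm]

lemma sum_star_pow_mul_of_amplitudes : ∑ R ∈ runs (j + 2), star (lam ^ dimerCount R) * u R =
    runNorm (‖lam‖ ^ 2) (j + 1) * a + star lam * (runNorm (‖lam‖ ^ 2) j * c) := by
  have hpow (d : ℕ) : ((‖lam‖ ^ 2 : ℝ) : ℂ) ^ d = star (lam ^ d) * lam ^ d := by
    rw [Complex.ofReal_pow, ← Complex.conj_mul', mul_pow, star_pow, starRingEnd_apply]
  rw [sum_runs_add_two, ← sum_runs_pow_dimerCount, ← sum_runs_pow_dimerCount]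
  simp only [Complex.ofReal_sum, Complex.ofReal_pow _ (dimerCount _), hpow, Finset.sum_mul,
    Finset.mul_sum]
  congr 1 <;> refine Finset.sum_congr rfl fun R hR => ?_
  · rw [hM R hR]
    simp [Tile.dimers, mul_assoc]
  · rw [hD R hR]
    simp [Tile.dimers, pow_add]
    ring

end ExcitedState

lemma norm_sq_amplitudes {a c : ℂ} {p p' : ℝ} (hp : p ≠ 0)
    (ho : p * a + star lam * (p' * c) = 0) :
    ‖(1 + star lam * lam) * a + star lam * c‖ ^ 2 =
        ‖lam‖ ^ 2 * (1 - p' / p * (1 + ‖lam‖ ^ 2)) ^ 2 * ‖c‖ ^ 2 ∧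
      ‖lam * (a + star lam * c)‖ ^ 2 = (‖lam‖ ^ 2) ^ 2 * (1 - p' / p) ^ 2 * ‖c‖ ^ 2 ∧
      ‖a‖ ^ 2 = ‖lam‖ ^ 2 * (p' / p) ^ 2 * ‖c‖ ^ 2 := by
  have ha : a = ((-(p' / p) : ℝ) : ℂ) * (star lam * c) := by
    have : (p : ℂ) ≠ 0 := by exact_mod_cast hp
    push_cast
    field_simp
    linear_combination ho
  have hsq : star lam * lam = ((‖lam‖ ^ 2 : ℝ) : ℂ) := by
    rw [Complex.ofReal_pow]
    exact Complex.conj_mul' lam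
  have h₁ : (1 + star lam * lam) * a + star lam * c =
      ((1 - p' / p * (1 + ‖lam‖ ^ 2) : ℝ) : ℂ) * (star lam * c) := by
    rw [ha, hsq]
    push_cast
    ring
  have h₂ : a + star lam * c = ((1 - p' / p : ℝ) : ℂ) * (star lam * c) := by
    rw [ha]
    push_cast
    ring
  rw [h₁, h₂, ha]
  simp only [norm_mul, norm_star, Complex.norm_real, Real.norm_eq_abs, mul_pow, sq_abs]
  exact ⟨by ring, by ring, by ring⟩

section Overlap

variable {i : ℕ} {u w : List Tile → ℂ} {a c : ℂ}
  (hM : ∀ R ∈ runs (i + 3), u (R ++ [.M]) = lam ^ dimerCount R * a)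
  (hD : ∀ R ∈ runs (i + 2), u (R ++ [.D]) = lam ^ dimerCount R * c)
  (hw : ∀ X Y, X ++ .D :: Y ∈ runs (i + 4) → 3 * (i + 1) ≤ size X →
    w (X ++ .D :: Y) = lam * w (X ++ .M :: .M :: Y))
include hM hD hw

lemma sum_star_mul_eq_of_amplitudes : ∑ R ∈ runs (i + 4), star (w R) * u R =
    ((1 + star lam * lam) * a + star lam * c)
        * ∑ R ∈ runs (i + 1), star (w (R ++ [.M, .M, .M])) * lam ^ dimerCount R
      + lam * (a + star lam * c)
        * ∑ R ∈ runs i, star (w (R ++ [.D, .M, .M])) * lam ^ dimerCount R := by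
  rw [sum_runs_add_four, Finset.mul_sum, Finset.mul_sum]
  congr 1 <;> refine Finset.sum_congr rfl fun R hR => ?_
  · have hRM : R ++ [.M] ∈ runs (i + 2) := append_monomer_mem_runs_iff.2 hR
    have hMMM := hM _ (append_monomer_mem_runs_iff.2 hRM)
    have hDM := hM _ (append_dimer_mem_runs_iff.2 hR)
    have hMD := hD _ hRM
    simp only [List.append_assoc, List.cons_append, List.nil_append, dimerCount_append,
      dimerCount_cons, dimerCount_nil, Tile.dimers, add_zero, pow_succ] at hMMM hDM hMD
    obtain ⟨hwDM, hwMD⟩ := eq_of_relations_of_mem_runs_succ hw hR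
    rw [hMMM, hDM, hMD, hwDM, hwMD, star_mul]
    ring
  · have hRD : R ++ [.D] ∈ runs (i + 2) := append_dimer_mem_runs_iff.2 hR
    have hDMM := hM _ (append_monomer_mem_runs_iff.2 hRD)
    have hDD := hD _ hRD
    simp only [List.append_assoc, List.cons_append, List.nil_append, dimerCount_append,
      dimerCount_cons, dimerCount_nil, Tile.dimers, add_zero, pow_succ] at hDMM hDD
    rw [hDMM, hDD, eq_of_relations_of_mem_runs hw hR, star_mul]
    ring

lemma norm_sum_star_mul_sq_le_of_amplitudes
    (ho : runNorm (‖lam‖ ^ 2) (i + 3) * a + star lam * (runNorm (‖lam‖ ^ 2) (i + 2) * c) = 0) :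
    ‖∑ R ∈ runs (i + 4), star (w R) * u R‖ ^ 2 ≤ fk (i + 4) (‖lam‖ ^ 2)
      * (∑ R ∈ runs (i + 4), ‖w R‖ ^ 2) * ∑ R ∈ runs (i + 4), ‖u R‖ ^ 2 := by
  rw [sum_star_mul_eq_of_amplitudes hM hD hw, sum_norm_sq_of_relations hw,
    sum_norm_sq_of_amplitudes hM hD]
  have hU := norm_sum_star_mul_pow_sq_le lam (fun R => w (R ++ [.M, .M, .M])) (i + 1)
  have hW := norm_sum_star_mul_pow_sq_le lam (fun R => w (R ++ [.D, .M, .M])) i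
  have hr : 0 ≤ ‖lam‖ ^ 2 := by positivity
  have pos3 := runNorm_pos hr (i + 3)
  obtain ⟨hamp₁, hamp₂, ha⟩ := norm_sq_amplitudes pos3.ne' ho
  have hu : runNorm (‖lam‖ ^ 2) (i + 3) * ‖a‖ ^ 2 + runNorm (‖lam‖ ^ 2) (i + 2) * ‖c‖ ^ 2 =
      ‖c‖ ^ 2 * (runNorm (‖lam‖ ^ 2) (i + 2) * runNorm (‖lam‖ ^ 2) (i + 4)
        / runNorm (‖lam‖ ^ 2) (i + 3)) := by
    rw [ha, show runNorm (‖lam‖ ^ 2) (i + 4) = runNorm (‖lam‖ ^ 2) (i + 3)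
      + ‖lam‖ ^ 2 * runNorm (‖lam‖ ^ 2) (i + 2) from rfl]
    field_simp
    ring
  refine (pow_le_pow_left₀ (norm_nonneg _) (norm_add_le _ _) 2).trans ?_
  rw [norm_mul, norm_mul]
  refine (mul_add_mul_sq_le (s := 1 + 2 * ‖lam‖ ^ 2) (s' := 1 + ‖lam‖ ^ 2) (by positivity)
    (by positivity) (runNorm_pos hr _).le (runNorm_pos hr _).le
    (Finset.sum_nonneg fun _ _ => by positivity) (Finset.sum_nonneg fun _ _ => by positivity)
    hU hW).trans_eq ?_
  rw [mul_right_comm, hamp₁, hamp₂, hu]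
  congr 1
  linear_combination (-‖c‖ ^ 2) * fk_mul_runNorm hr i

end Overlap

lemma norm_sum_star_mul_sq_le {j : ℕ} {u w : List Tile → ℂ}
    (hu : ∀ X Y t, X ++ .D :: (Y ++ [t]) ∈ runs j →
      u (X ++ .D :: (Y ++ [t])) = lam * u (X ++ .M :: .M :: (Y ++ [t])))
    (hw : ∀ X Y, X ++ .D :: Y ∈ runs j → 3 * j ≤ size X + 9 →
      w (X ++ .D :: Y) = lam * w (X ++ .M :: .M :: Y))
    (ho : ∑ R ∈ runs j, star (lam ^ dimerCount R) * u R = 0) :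
    ‖∑ R ∈ runs j, star (w R) * u R‖ ^ 2
      ≤ f (‖lam‖ ^ 2) * (∑ R ∈ runs j, ‖w R‖ ^ 2) * ∑ R ∈ runs j, ‖u R‖ ^ 2 := by
  have hr : 0 ≤ ‖lam‖ ^ 2 := by positivity
  obtain hj | hj := le_or_gt j 3
  · have hamp : ∀ R ∈ runs j, w R = lam ^ dimerCount R * w (List.replicate j .M) :=
      fun R => eq_pow_dimerCount_mul fun X Y hXY => hw X Y hXY (by omega)
    have hzero : ∑ R ∈ runs j, star (w R) * u R = 0 := by
      rw [← mul_zero (star (w (List.replicate j .M))), ← ho, Finset.mul_sum]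
      refine Finset.sum_congr rfl fun R hR => ?_
      rw [hamp R hR, star_mul, mul_assoc]
    rw [hzero, norm_zero, zero_pow two_ne_zero]
    have := f_nonneg hr
    positivity
  · obtain ⟨i, rfl⟩ := Nat.exists_eq_add_of_le' hj
    have hM : ∀ R ∈ runs (i + 3), u (R ++ [.M]) = lam ^ dimerCount R * _ := fun R =>
      eq_pow_dimerCount_mul (g := fun R => u (R ++ [.M])) fun X Y hXY => by
        simpa using hu X Y .M (by simpa using append_monomer_mem_runs_iff.2 hXY)
    have hD : ∀ R ∈ runs (i + 2), u (R ++ [.D]) = lam ^ dimerCount R * _ := fun R =>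
      eq_pow_dimerCount_mul (g := fun R => u (R ++ [.D])) fun X Y hXY => by
        simpa using hu X Y .D (by simpa using append_dimer_mem_runs_iff.2 hXY)
    rw [sum_star_pow_mul_of_amplitudes hM hD] at ho
    refine (norm_sum_star_mul_sq_le_of_amplitudes hM hD
      (fun X Y hXY hX => hw X Y hXY (by omega)) ho).trans ?_
    gcongr
    exact fk_le_f hr (by omega)

end SingleRun

/-! ### The spectral gap of short intervals -/

lemma eq_or_size_add_le_of_append_cons_eq {X X' Y Y' : List Tile} {t t' : Tile}
    (h : X ++ t :: Y = X' ++ t' :: Y') : (X = X' ∧ t = t' ∧ Y = Y') ∨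
      size X + t.word.length ≤ size X' ∨ size X' + t'.word.length ≤ size X := by
  obtain ⟨Z, rfl, hZ⟩ | ⟨Z, rfl, hZ⟩ := List.append_eq_append_iff.1 h
  all_goals
    obtain _ | ⟨s, Z⟩ := Z
    · simp_all
    · obtain ⟨rfl, -⟩ := List.cons.inj hZ
      simp only [size_append, size_cons]
      omega

lemma size_add_six_le_of_monomers_dimer {X X' Y Y' : List Tile}
    (h : X ++ .M :: .M :: Y = X' ++ .D :: Y') : size X + 6 ≤ size X' ∨ size X' + 6 ≤ size X := by
  have first := eq_or_size_add_le_of_append_cons_eq h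
  have second := eq_or_size_add_le_of_append_cons_eq (X := X ++ [.M]) (by simpa using h)
  simp only [reduceCtorEq, false_and, and_false, false_or, size_append, size_cons, size_nil,
    Tile.word, List.length_cons, List.length_nil] at first second
  omega

section ShortInterval

variable {a b : ℕ} (lam : ℂ)

lemma exists_amplitude_of_dimer (F : List Tile → ℂ) (hab : b ≤ a + 8) :
    ∃ G : List Tile → ℂ,
      (∀ X Y, a ≤ size X → size X + 3 ≤ b →
        G (X ++ .D :: Y) = lam * F (X ++ .M :: .M :: Y)) ∧
      ∀ T, (∀ X Y, T = X ++ .D :: Y → a ≤ size X → b < size X + 3) → G T = F T := by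
  classical
  refine ⟨fun T => if h : ∃ p : List Tile × List Tile,
      T = p.1 ++ .D :: p.2 ∧ a ≤ size p.1 ∧ size p.1 + 3 ≤ b
    then lam * F (h.choose.1 ++ .M :: .M :: h.choose.2) else F T, fun X Y h1 h2 => ?_,
    fun T hT => dif_neg ?_⟩
  · have h : ∃ p : List Tile × List Tile,
        X ++ .D :: Y = p.1 ++ .D :: p.2 ∧ a ≤ size p.1 ∧ size p.1 + 3 ≤ b := ⟨(X, Y), rfl, h1, h2⟩
    have hchoose := h.choose_spec
    have disjoint := eq_or_size_add_le_of_append_cons_eq hchoose.1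
    simp only [Tile.word, List.length_cons, List.length_nil] at disjoint
    obtain ⟨hX, -, hY⟩ := disjoint.resolve_right (by omega)
    simp only [dif_pos h, ← hX, ← hY]
  · rintro ⟨p, hp, h1, h2⟩
    have := hT p.1 p.2 hp h1
    omega

lemma sum_norm_sub_sq_le (ha : 1 ≤ a) (hb : b ≤ L) (ψ : Hilb L) {G : List Tile → ℂ}
    (hdimer : ∀ X Y, a ≤ size X → size X + 3 ≤ b →
      G (X ++ .D :: Y) = lam * ψ (cfg L (X ++ .M :: .M :: Y)))
    (hrest : ∀ T, (∀ X Y, T = X ++ .D :: Y → a ≤ size X → b < size X + 3) → G T = ψ (cfg L T)) :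
    ∑ T ∈ tilings L, ‖ψ (cfg L T) - G T‖ ^ 2
      ≤ ∑ x ∈ Finset.Icc a (b - 3), ‖q L lam x ψ‖ ^ 2 := by
  classical
  have exists_dimer (T : List Tile) (hT : G T ≠ ψ (cfg L T)) :
      ∃ X Y, T = X ++ .D :: Y ∧ a ≤ size X ∧ size X + 3 ≤ b := by
    contrapose! hT
    exact hrest T hT
  choose! X Y hXY using exists_dimer
  let void (T : List Tile) : ℕ × Config L := (size (X T), cfg L (X T ++ (sixVoids ++ Y T)))
  set S := {T ∈ tilings L | G T ≠ ψ (cfg L T)} with hS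
  have void_injOn : Set.InjOn void S := by
    intro T hT T' hT' h
    simp only [hS, Finset.coe_filter, mem_tilings, Set.mem_ofPred_eq] at hT hT'
    obtain ⟨e, -, h2⟩ := hXY T hT.2
    obtain ⟨e', -, -⟩ := hXY T' hT'.2
    obtain ⟨hx, hν⟩ := Prod.ext_iff.1 h
    have hx : size (X T') = size (X T) := hx.symm
    refine hT.1.cfg_injective hT'.1 ?_
    rw [e, e', ← (setPair_cfg_dimer (by omega) rfl).2, ← (setPair_cfg_dimer (by omega) hx).2]
    exact congrArg _ hν
  have q_void (T : List Tile) (hT : T ∈ S) :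
      ‖ψ (cfg L T) - G T‖ ^ 2 = ‖q L lam (void T).1 ψ (void T).2‖ ^ 2 := by
    obtain ⟨e, h1, h2⟩ := hXY T (Finset.mem_filter.1 hT).2
    rw [q_apply_sixVoids (by omega) (by omega) lam ψ rfl, ← hdimer _ _ h1 h2, ← e]
  calc ∑ T ∈ tilings L, ‖ψ (cfg L T) - G T‖ ^ 2
      = ∑ T ∈ S, ‖ψ (cfg L T) - G T‖ ^ 2 := by
        refine (Finset.sum_filter_of_ne fun T _ hT => ?_).symm
        contrapose! hT
        rw [hT, sub_self, norm_zero, zero_pow two_ne_zero]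
    _ = ∑ p ∈ S.image void, ‖q L lam p.1 ψ p.2‖ ^ 2 := by
        rw [Finset.sum_image void_injOn, Finset.sum_congr rfl q_void]
    _ ≤ ∑ p ∈ Finset.Icc a (b - 3) ×ˢ Finset.univ, ‖q L lam p.1 ψ p.2‖ ^ 2 := by
        refine Finset.sum_le_sum_of_subset_of_nonneg ?_ fun _ _ _ => by positivity
        refine Finset.image_subset_iff.2 fun T hT => ?_
        obtain ⟨-, h1, h2⟩ := hXY T (Finset.mem_filter.1 hT).2
        exact Finset.mem_product.2
          ⟨Finset.mem_Icc.2 ⟨h1, Nat.le_sub_of_add_le h2⟩, Finset.mem_univ _⟩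
    _ = ∑ x ∈ Finset.Icc a (b - 3), ‖q L lam x ψ‖ ^ 2 := by
        simp only [Finset.sum_product, EuclideanSpace.norm_sq_eq]

lemma exists_ham_eq_zero_mul_norm_sub_sq_le {κ : ℝ} (hκ : 0 < κ) (hL : 5 ≤ L) (ha : 1 ≤ a)
    (hab : a + 3 ≤ b) (hab' : b ≤ a + 8) (hb : b ≤ L) {ψ : Hilb L} (hψ : ψ ∈ tilingSpace L) :
    ∃ χ, Ham L κ lam a b χ = 0 ∧ κ * ‖ψ - χ‖ ^ 2 ≤ (inner ℂ ψ (Ham L κ lam a b ψ)).re := by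
  obtain ⟨G, hdimer, hrest⟩ := exists_amplitude_of_dimer lam (fun T => ψ (cfg L T)) hab'
  have hχ := tilingVec_mem_tilingSpace hL G
  refine ⟨tilingVec L G, (ham_eq_zero_iff_isRelated κ lam hL ha hab hb hχ hκ).2 ?_, ?_⟩
  · intro X Y hT h1 h2
    have hMM := (isPadded_monomers_iff (by omega) (h2.trans hb) rfl).2 hT
    beta_reduce
    rw [tilingVec_apply G hT, tilingVec_apply G hMM, hdimer X Y h1 h2, hrest]
    intro X' Y' h h1'
    have := size_add_six_le_of_monomers_dimer h
    omega
  · rw [inner_ham_eq_sum κ lam hL ha hab hb hψ, Complex.ofReal_re,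
      norm_sq_eq_sum_tilings hL (Submodule.sub_mem _ hψ hχ)]
    refine mul_le_mul_of_nonneg_left ?_ hκ.le
    refine le_of_eq_of_le (Finset.sum_congr rfl fun T hT => ?_)
      (sum_norm_sub_sq_le lam ha hb ψ hdimer hrest)
    rw [PiLp.sub_apply, tilingVec_apply G (mem_tilings.1 hT)]

end ShortInterval

/-! ### The last run of a tiling -/

lemma three_le_size_of_isPolymer {R : List Tile} (hR : ∀ t ∈ R, t.IsPolymer) (hne : R ≠ []) :
    3 ≤ size R := by
  obtain ⟨t, R, rfl⟩ := List.exists_cons_of_ne_nil hne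
  rw [size_cons]
  obtain rfl | rfl := hR t List.mem_cons_self <;> simp only [Tile.word, List.length_cons] <;> omega

lemma eq_nil_of_append_eq_append {P Q R C : List Tile} (hR : ∀ t ∈ R, t.IsPolymer)
    (h : P ++ R = Q ++ C) (hle : size C ≤ size R) (hC : size C < 3) : C = [] := by
  by_contra hne
  obtain ⟨Z, -, rfl⟩ | ⟨Z, -, rfl⟩ := List.append_eq_append_iff.1 h
  · rw [List.forall_mem_append] at hR
    exact (three_le_size_of_isPolymer hR.2 hne).not_gt hC
  · rw [size_append] at hle hC
    obtain rfl : Z = [] := by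
      by_contra hZ
      have := size_pos hZ
      omega
    exact (three_le_size_of_isPolymer hR hne).not_gt (by simpa using hC)

lemma occupied_eq_false_of_mem_runs {j i : ℕ} {R : List Tile} (hR : R ∈ runs j)
    (hi : 3 * j ≤ i + 2) : occupied R i = false := by
  obtain ⟨htiles, hsize⟩ := mem_runs.1 hR
  rcases lt_or_ge i (size R) with hiR | hiR
  · obtain rfl | ⟨S, t, rfl⟩ := List.eq_nil_or_concat' R
    · rfl
    obtain rfl | rfl := htiles t (by simp) <;>
    · simp only [size_append, size_cons, size_nil, Tile.word, List.length_cons,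
        List.length_nil] at hsize hiR
      obtain ⟨k, rfl⟩ := Nat.exists_eq_add_of_le (show size S ≤ i by omega)
      rw [occupied_append_tile _ _ (by simp only [Tile.word, List.length_cons]; omega)]
      first
      | obtain rfl | rfl : k = 1 ∨ k = 2 := by omega
        all_goals rfl
      | obtain rfl | rfl : k = 4 ∨ k = 5 := by omega
        all_goals rfl
  · by_contra hocc
    exact hiR.not_gt (lt_size_of_occupied (Bool.eq_true_of_not_eq_false hocc))

lemma exists_maximal_run {X : List Tile} (hX : X ≠ []) :
    ∃ A j, A ≠ [] ∧ (∀ C t, A = C ++ [t] → C ≠ [] → ¬ t.IsPolymer) ∧ ∃ R ∈ runs j, X = A ++ R := by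
  induction X using List.reverseRecOn with
  | nil => exact absurd rfl hX
  | append_singleton X t ih =>
    by_cases ht : X ≠ [] ∧ t.IsPolymer
    · obtain ⟨A, j, hA, hmax, R, hR, rfl⟩ := ih ht.1
      obtain rfl | rfl := ht.2
      · exact ⟨A, j + 1, hA, hmax, R ++ [.M], append_monomer_mem_runs_iff.2 hR, by simp⟩
      · exact ⟨A, j + 2, hA, hmax, R ++ [.D], append_dimer_mem_runs_iff.2 hR, by simp⟩
    · refine ⟨X ++ [t], 0, hX, fun C s e hC hs => ht ?_, [], by simp [runs_zero], by simp⟩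
      obtain ⟨rfl, rfl⟩ := List.append_singleton_inj.1 e
      exact ⟨hC, hs⟩

/-- `A` is a possible beginning of a tiling, followed by a run `R ∈ runs j` that is maximal to the
left and contains the last bond `x, …, x + 3` of `[1, b]` at which a dimer can sit; the right end
`size A + 3 * j - 3` of that bond is one of `b - 2`, `b - 1`, `b`. The first tile does not belong to
the run, since the dimer that encodes the boundary tile `Bl` cannot be opened. -/
structure PrecedesLastRun (b : ℕ) (A : List Tile) (j : ℕ) : Prop where
  ne_nil : A ≠ []
  two_le : 2 ≤ j
  maximal : ∀ C t, A = C ++ [t] → C ≠ [] → ¬ t.IsPolymer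
  le_end : b + 1 ≤ size A + 3 * j
  end_le : size A + 3 * j ≤ b + 3

/-- `T` contains a run as in `PrecedesLastRun`. -/
def HasLastRun (b : ℕ) (T : List Tile) : Prop :=
  ∃ A j B, PrecedesLastRun b A j ∧ ∃ R ∈ runs j, T = A ++ (R ++ B)

namespace PrecedesLastRun

variable {b j j' : ℕ} {A A' R R' B B' X Y P : List Tile}

lemma size_pos (h : PrecedesLastRun b A j) : 0 < size A := FQH.size_pos h.ne_nil

lemma append_run_eq_of_prefix (h : PrecedesLastRun b A j) (h' : PrecedesLastRun b A' j')
    (hR : R ∈ runs j) (hR' : R' ∈ runs j') {C : List Tile} (e : A' ++ R' = A ++ R ++ C) :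
    A' ++ R' = A ++ R := by
  have hsize := congrArg size e
  obtain ⟨hpolymer, hR's⟩ := mem_runs.1 hR'
  have hRs := (mem_runs.1 hR).2
  simp only [size_append] at hsize
  have := h.le_end
  have := h'.end_le
  have := h'.two_le
  rw [e, eq_nil_of_append_eq_append hpolymer e (by omega) (by omega), List.append_nil]

lemma eq_nil_of_isPolymer (h : PrecedesLastRun b A j) (hX : X ≠ []) (hR : ∀ t ∈ R, t.IsPolymer)
    (e : A = X ++ R) : R = [] := by
  obtain rfl | ⟨R, t, rfl⟩ := List.eq_nil_or_concat' R
  · rfl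
  · rw [← List.append_assoc] at e
    exact absurd (hR t (by simp)) (h.maximal _ t e (by simp [hX]))

lemma unique (h : PrecedesLastRun b A j) (h' : PrecedesLastRun b A' j') (hR : R ∈ runs j)
    (hR' : R' ∈ runs j') (e : A ++ (R ++ B) = A' ++ (R' ++ B')) :
    A = A' ∧ j = j' ∧ R = R' ∧ B = B' := by
  have hAR : A ++ R = A' ++ R' := by
    rw [← List.append_assoc, ← List.append_assoc] at e
    obtain ⟨C, e', -⟩ | ⟨C, e', -⟩ := List.append_eq_append_iff.1 e
    · exact (h.append_run_eq_of_prefix h' hR hR' e').symm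
    · exact h'.append_run_eq_of_prefix h hR' hR e'
  obtain ⟨hpolymer, hsize⟩ := mem_runs.1 hR
  obtain ⟨hpolymer', hsize'⟩ := mem_runs.1 hR'
  obtain rfl : A = A' := by
    obtain ⟨C, eA, rfl⟩ | ⟨C, eA, rfl⟩ := List.append_eq_append_iff.1 hAR
    · rw [eA, h'.eq_nil_of_isPolymer h.ne_nil (List.forall_mem_append.1 hpolymer).1 eA,
        List.append_nil]
    · rw [eA, h.eq_nil_of_isPolymer h'.ne_nil (List.forall_mem_append.1 hpolymer').1 eA,
        List.append_nil]
  obtain rfl : R = R' := List.append_cancel_left hAR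
  exact ⟨rfl, by omega, rfl, List.append_cancel_left (List.append_cancel_left e)⟩

lemma isPadded (h : PrecedesLastRun b A j) (hb : b ≤ L) (hR : R ∈ runs j) (hR' : R' ∈ runs j)
    (hT : IsPadded L (A ++ (R ++ B))) : IsPadded L (A ++ (R' ++ B)) := by
  have := h.end_le
  refine hT.append h.size_pos (fun t ht => ((mem_runs.1 hR').1 t ht).isBulk) ?_ fun i hi =>
    occupied_eq_false_of_mem_runs hR' (by omega)
  rw [(mem_runs.1 hR').2, (mem_runs.1 hR).2]

lemma append_cases (h : PrecedesLastRun b A j) (hR : R ∈ runs j) (hP : P ∈ runs 2) (hX : X ≠ [])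
    (hXb : size X + 3 ≤ b) (e : X ++ (P ++ Y) = A ++ (R ++ B)) :
    (∃ C, A = X ++ (P ++ C) ∧ Y = C ++ (R ++ B)) ∨
      ∃ R₁ R₂, R = R₁ ++ (P ++ R₂) ∧ X = A ++ R₁ ∧ Y = R₂ ++ B := by
  obtain ⟨hpolymer, hPsize⟩ := mem_runs.1 hP
  have hRsize := (mem_runs.1 hR).2
  have := h.le_end
  have inside {R₁ : List Tile} (hXA : X = A ++ R₁) (e : R₁ ++ (P ++ Y) = R ++ B) :
      ∃ R₁ R₂, R = R₁ ++ (P ++ R₂) ∧ X = A ++ R₁ ∧ Y = R₂ ++ B := by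
    rw [← List.append_assoc] at e
    obtain ⟨C, e', hY⟩ | ⟨C, e', hB⟩ := List.append_eq_append_iff.1 e
    · exact ⟨R₁, C, by rw [e', List.append_assoc], hXA, hY⟩
    · have hsize := congrArg size e'
      rw [hXA, size_append] at hXb
      simp only [size_append] at hsize
      obtain rfl := eq_nil_of_append_eq_append hpolymer e' (by omega) (by omega)
      rw [List.append_nil] at e'
      exact ⟨R₁, [], by rw [← e', List.append_nil], hXA, hB.symm⟩
  obtain ⟨C, hA, e⟩ | ⟨R₁, hXA, e⟩ := List.append_eq_append_iff.1 e
  · obtain ⟨C', rfl, hY⟩ | ⟨C', hPC, -⟩ := List.append_eq_append_iff.1 e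
    · exact Or.inl ⟨C', hA, hY⟩
    · rw [hPC] at hpolymer
      obtain rfl := h.eq_nil_of_isPolymer hX (List.forall_mem_append.1 hpolymer).1 hA
      exact Or.inr (inside (R₁ := []) (by simp [hA]) (by simpa using e))
  · exact Or.inr (inside hXA e.symm)

lemma dimer_iff (hX : X ≠ []) :
    PrecedesLastRun b (X ++ .D :: Y) j ↔ PrecedesLastRun b (X ++ .M :: .M :: Y) j := by
  have hsize : size (X ++ .D :: Y) = size (X ++ .M :: .M :: Y) := by
    simp [Tile.word, ← add_assoc]
  have maximal_iff : (∀ C t, X ++ .D :: Y = C ++ [t] → C ≠ [] → ¬ t.IsPolymer) ↔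
      ∀ C t, X ++ .M :: .M :: Y = C ++ [t] → C ≠ [] → ¬ t.IsPolymer := by
    obtain rfl | ⟨Y, s, rfl⟩ := List.eq_nil_or_concat' Y
    · refine iff_of_false (fun h => h X .D rfl hX (Or.inr rfl)) fun h => ?_
      exact h (X ++ [.M]) .M (by simp) (by simp) (Or.inl rfl)
    · have concat_iff (Z : List Tile) (hZ : Z ≠ []) :
          (∀ C t, Z ++ [s] = C ++ [t] → C ≠ [] → ¬ t.IsPolymer) ↔ ¬ s.IsPolymer := by
        refine ⟨fun h => h Z s rfl hZ, fun h C t e _ => ?_⟩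
        rwa [← (List.append_singleton_inj.1 e).2]
      rw [← List.cons_append, ← List.append_assoc, ← List.cons_append, ← List.cons_append,
        ← List.append_assoc, concat_iff _ (by simp), concat_iff _ (by simp)]
  exact ⟨fun h => ⟨by simp, h.two_le, maximal_iff.1 h.maximal, hsize ▸ h.le_end, hsize ▸ h.end_le⟩,
    fun h => ⟨by simp, h.two_le, maximal_iff.2 h.maximal, hsize ▸ h.le_end, hsize ▸ h.end_le⟩⟩

lemma exists_append_dimer (hX : X ≠ []) (hXb : size X + 3 ≤ b) (hbX : b < size X + 6) :
    ∃ A j, PrecedesLastRun b A j ∧ ∃ R ∈ runs j, X ++ [.D] = A ++ R := by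
  obtain ⟨A, i, hA, hmax, R, hR, rfl⟩ := exists_maximal_run hX
  refine ⟨A, i + 2, ⟨hA, by omega, hmax, ?_, ?_⟩, R ++ [.D], append_dimer_mem_runs_iff.2 hR,
    List.append_assoc _ _ _⟩
  all_goals
    rw [size_append, (mem_runs.1 hR).2] at hXb hbX
    omega

end PrecedesLastRun

/-- The triples `(A, j, B)` that index the classes of padded tilings `A ++ (R ++ B)`, `R ∈ runs j`,
differing in the last run only. -/
def lastRuns (L b : ℕ) : Finset (List Tile × ℕ × List Tile) :=
  Set.Finite.toFinset (s := {c | PrecedesLastRun b c.1 c.2.1 ∧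
      IsPadded L (c.1 ++ (List.replicate c.2.1 .M ++ c.2.2))}) <| by
    refine Set.Finite.of_injOn (t := tilings L)
      (f := fun c => c.1 ++ (List.replicate c.2.1 .M ++ c.2.2))
      (fun c hc => Finset.mem_coe.2 (mem_tilings.2 hc.2)) ?_ (tilings L).finite_toSet
    intro c hc c' hc' e
    obtain ⟨hA, hj, -, hB⟩ :=
      hc.1.unique hc'.1 (replicate_mem_runs _) (replicate_mem_runs _) e
    exact Prod.ext hA (Prod.ext hj hB)

section LastRuns

variable {b : ℕ}

lemma mem_lastRuns {A B : List Tile} {j : ℕ} :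
    (A, j, B) ∈ lastRuns L b ↔
      PrecedesLastRun b A j ∧ IsPadded L (A ++ (List.replicate j .M ++ B)) := by
  simp [lastRuns]

lemma isPadded_of_mem_lastRuns (hb : b ≤ L) {A B R : List Tile} {j : ℕ}
    (h : (A, j, B) ∈ lastRuns L b) (hR : R ∈ runs j) : IsPadded L (A ++ (R ++ B)) :=
  have ⟨hA, hT⟩ := mem_lastRuns.1 h
  hA.isPadded hb (replicate_mem_runs j) hR hT

open Classical in
lemma sum_hasLastRun (hb : b ≤ L) {E : Type*} [AddCommMonoid E] (F : List Tile → E) :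
    ∑ T ∈ tilings L with HasLastRun b T, F T
      = ∑ c ∈ lastRuns L b, ∑ R ∈ runs c.2.1, F (c.1 ++ (R ++ c.2.2)) := by
  rw [Finset.sum_sigma']
  symm
  refine Finset.sum_nbij (fun p => p.1.1 ++ (p.2 ++ p.1.2.2)) ?_ ?_ ?_ fun _ _ => rfl
  · rintro ⟨⟨A, j, B⟩, R⟩ h
    obtain ⟨hc, hR⟩ := Finset.mem_sigma.1 h
    exact Finset.mem_filter.2 ⟨mem_tilings.2 (isPadded_of_mem_lastRuns hb hc hR),
      A, j, B, (mem_lastRuns.1 hc).1, R, hR, rfl⟩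
  · rintro ⟨⟨A, j, B⟩, R⟩ h ⟨⟨A', j', B'⟩, R'⟩ h' e
    obtain ⟨hc, hR⟩ := Finset.mem_sigma.1 h
    obtain ⟨hc', hR'⟩ := Finset.mem_sigma.1 h'
    obtain ⟨rfl, rfl, rfl, rfl⟩ :=
      (mem_lastRuns.1 hc).1.unique (mem_lastRuns.1 hc').1 hR hR' e
    rfl
  · intro T hT
    obtain ⟨hT, A, j, B, hA, R, hR, rfl⟩ := Finset.mem_filter.1 hT
    refine ⟨⟨(A, j, B), R⟩, Finset.mem_sigma.2 ⟨mem_lastRuns.2 ⟨hA, ?_⟩, hR⟩, rfl⟩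
    exact hA.isPadded hb hR (replicate_mem_runs j) (mem_tilings.1 hT)

lemma size_append_dimer (X Y : List Tile) : size (X ++ .D :: Y) = size X + 6 + size Y := by
  rw [size_append, size_cons, ← add_assoc]
  rfl

section Projection

variable (lam : ℂ) (F : List Tile → ℂ)

/-- The overlap of an amplitude on the class of tilings `A ++ (R ++ B)`, `R ∈ runs j`, with the
ground state `∑ lam ^ dimerCount R • |R⟩` of the run. -/
def overlap (A : List Tile) (j : ℕ) (B : List Tile) : ℂ :=
  ∑ R ∈ runs j, star (lam ^ dimerCount R) * F (A ++ (R ++ B))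

/-- `G` is, up to positive factors, the projection of the amplitude `F` to the ground state of the
last run: it is proportional to the ground state on every class, and `F` off the classes. -/
structure IsLastRunProjection (b : ℕ) (G : List Tile → ℂ) : Prop where
  apply_run {A B R : List Tile} {j : ℕ} (hA : PrecedesLastRun b A j) (hR : R ∈ runs j) :
    G (A ++ (R ++ B)) = lam ^ dimerCount R * overlap lam F A j B
  apply_of_not {T : List Tile} (hT : ¬ HasLastRun b T) : G T = F T

lemma exists_isLastRunProjection (b : ℕ) : ∃ G, IsLastRunProjection lam F b G := by
  classical
  choose! A j B hA R hR hT using fun (T : List Tile) (h : HasLastRun b T) => h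
  refine ⟨fun T => if HasLastRun b T then
    lam ^ dimerCount (R T) * overlap lam F (A T) (j T) (B T) else F T, ?_, fun h => if_neg h⟩
  intro A' B' R' j' hA' hR'
  have h : HasLastRun b (A' ++ (R' ++ B')) := ⟨A', j', B', hA', R', hR', rfl⟩
  obtain ⟨eA, ej, eR, eB⟩ := hA'.unique (hA _ h) hR' (hR _ h) (hT _ h)
  rw [if_pos h, ← eA, ← ej, ← eR, ← eB]

variable {lam F} {G : List Tile → ℂ}

lemma PrecedesLastRun.overlap_dimer {X B C R : List Tile} {j : ℕ}
    (hA : PrecedesLastRun b (X ++ .D :: C) j) (hF : IsRelated L lam F 1 (b - 3)) (hb : b ≤ L)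
    (hX : 1 ≤ size X) (hR : R ∈ runs j) (hT : IsPadded L (X ++ .D :: C ++ (R ++ B))) :
    overlap lam F (X ++ .D :: C) j B = lam * overlap lam F (X ++ .M :: .M :: C) j B := by
  rw [overlap, overlap, Finset.mul_sum]
  refine Finset.sum_congr rfl fun S hS => ?_
  have hTS := hA.isPadded hb hR hS hT
  have := hA.two_le
  have hend := hA.end_le
  rw [size_append_dimer] at hend
  simp only [List.append_assoc, List.cons_append] at hTS ⊢
  rw [hF X (C ++ (S ++ B)) hTS hX (by omega)]
  ring

lemma HasLastRun.dimer_of_monomers {X Y : List Tile} (hX : X ≠ []) (hXb : size X + 3 ≤ b)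
    (h : HasLastRun b (X ++ .M :: .M :: Y)) : HasLastRun b (X ++ .D :: Y) := by
  obtain ⟨A, j, B, hA, R, hR, e⟩ := h
  obtain ⟨C, rfl, rfl⟩ | ⟨R₁, R₂, rfl, rfl, rfl⟩ :=
    hA.append_cases hR (replicate_mem_runs 2) hX hXb e
  · exact ⟨X ++ .D :: C, j, B, (PrecedesLastRun.dimer_iff hX).2 hA, R, hR, by simp⟩
  · exact ⟨A, j, B, hA, R₁ ++ .D :: R₂, dimer_mem_runs_iff.2 hR, by simp⟩

lemma IsLastRunProjection.isRelated (hG : IsLastRunProjection lam F b G) (hb : b ≤ L)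
    (hF : IsRelated L lam F 1 (b - 3)) : IsRelated L lam G 1 b := by
  intro X Y hT hX hXb
  have hX' : X ≠ [] := by
    rintro rfl
    simp at hX
  by_cases h : HasLastRun b (X ++ .D :: Y)
  · obtain ⟨A, j, B, hA, R, hR, e⟩ := h
    rw [e] at hT ⊢
    have dimer_mem_runs : [.D] ∈ runs 2 := dimer_mem_runs_iff (X := []).2 (replicate_mem_runs 2)
    obtain ⟨C, rfl, rfl⟩ | ⟨R₁, R₂, rfl, rfl, rfl⟩ :=
      hA.append_cases hR dimer_mem_runs hX' hXb e
    · simp only [List.cons_append, List.nil_append] at hA hT ⊢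
      have hA' := (PrecedesLastRun.dimer_iff hX').1 hA
      have hMM := hG.apply_run hA' hR (B := B)
      simp only [List.append_assoc, List.cons_append] at hMM
      rw [hG.apply_run hA hR, hMM, hA.overlap_dimer hF hb hX hR hT]
      ring
    · simp only [List.cons_append, List.nil_append] at hR ⊢
      have hMM := hG.apply_run hA (dimer_mem_runs_iff.1 hR) (B := B)
      simp only [List.append_assoc, List.cons_append] at hMM
      rw [hG.apply_run hA hR, List.append_assoc, hMM]
      simp [Tile.dimers]
      ring
  · rw [hG.apply_of_not h, hG.apply_of_not (mt (.dimer_of_monomers hX' hXb) h)]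
    refine hF X Y hT hX ?_
    by_contra hbX
    obtain ⟨A, j, hA, R, hR, e⟩ := PrecedesLastRun.exists_append_dimer hX' hXb (by omega)
    exact h ⟨A, j, Y, hA, R, hR, by rw [← List.append_assoc, ← e, List.append_assoc]; rfl⟩

section Overlap

/-- Orthogonality of `F` to the amplitudes related up to `b`, all of whose dimers in `[1, b]` are
opened with weight `lam`. -/
def IsExcited (L b : ℕ) (lam : ℂ) (F : List Tile → ℂ) : Prop :=
  ∀ G, IsRelated L lam G 1 b → ∑ T ∈ tilings L, star (G T) * F T = 0

open Classical in
lemma IsLastRunProjection.sum_star_mul (hG : IsLastRunProjection lam F b G) (hb : b ≤ L) :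
    ∑ T ∈ tilings L, star (G T) * F T
      = ((∑ c ∈ lastRuns L b, ‖overlap lam F c.1 c.2.1 c.2.2‖ ^ 2
        + ∑ T ∈ tilings L with ¬ HasLastRun b T, ‖F T‖ ^ 2 : ℝ) : ℂ) := by
  rw [← Finset.sum_filter_add_sum_filter_not _ (HasLastRun b), sum_hasLastRun hb]
  push_cast
  congr 1
  · refine Finset.sum_congr rfl ?_
    rintro ⟨A, j, B⟩ hc
    rw [← Complex.conj_mul']
    change _ = starRingEnd ℂ (overlap lam F A j B)
      * ∑ R ∈ runs j, star (lam ^ dimerCount R) * F (A ++ (R ++ B))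
    rw [Finset.mul_sum]
    refine Finset.sum_congr rfl fun R hR => ?_
    rw [hG.apply_run (mem_lastRuns.1 hc).1 hR, star_mul, starRingEnd_apply]
    ring
  · refine Finset.sum_congr rfl fun T hT => ?_
    rw [hG.apply_of_not (Finset.mem_filter.1 hT).2]
    exact Complex.conj_mul' _

lemma eq_zero_of_isExcited (hb : b ≤ L) (hF : IsRelated L lam F 1 (b - 3))
    (ho : IsExcited L b lam F) :
    (∀ T ∈ tilings L, ¬ HasLastRun b T → F T = 0) ∧
      ∀ c ∈ lastRuns L b, overlap lam F c.1 c.2.1 c.2.2 = 0 := by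
  classical
  obtain ⟨G, hG⟩ := exists_isLastRunProjection lam F b
  have h := ho G (hG.isRelated hb hF)
  rw [hG.sum_star_mul hb, Complex.ofReal_eq_zero,
    add_eq_zero_iff_of_nonneg (by positivity) (by positivity),
    Finset.sum_eq_zero_iff_of_nonneg fun _ _ => by positivity,
    Finset.sum_eq_zero_iff_of_nonneg fun _ _ => by positivity] at h
  simp only [sq_eq_zero_iff, norm_eq_zero, Finset.mem_filter, and_imp] at h
  exact h.symm

lemma norm_sum_runs_sq_le (hb : b ≤ L) (hF : IsRelated L lam F 1 (b - 3))
    (hG : IsRelated L lam G (b - 8) b) {A B : List Tile} {j : ℕ} (hc : (A, j, B) ∈ lastRuns L b)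
    (ho : overlap lam F A j B = 0) :
    ‖∑ R ∈ runs j, star (G (A ++ (R ++ B))) * F (A ++ (R ++ B))‖ ^ 2
      ≤ f (‖lam‖ ^ 2) * (∑ R ∈ runs j, ‖G (A ++ (R ++ B))‖ ^ 2)
        * ∑ R ∈ runs j, ‖F (A ++ (R ++ B))‖ ^ 2 := by
  have hA := (mem_lastRuns.1 hc).1
  have := hA.size_pos
  have := hA.le_end
  have := hA.end_le
  refine norm_sum_star_mul_sq_le (fun X Y t hR => ?_) (fun X Y hR hX => ?_) ho
  all_goals
    have hT := isPadded_of_mem_lastRuns hb hc hR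
    have hsize := (mem_runs.1 hR).2
    rw [size_append_dimer] at hsize
    simp only [List.append_assoc, List.cons_append] at hT ⊢
    rw [← List.append_assoc] at hT ⊢
    rw [← List.append_assoc]
  · have := three_le_size_of_isPolymer (R := [t])
      (by simpa using (mem_runs.1 hR).1 t (by simp)) (by simp)
    rw [size_append] at hsize
    exact hF _ _ hT (by rw [size_append]; omega) (by rw [size_append]; omega)
  · exact hG _ _ hT (by rw [size_append]; omega) (by rw [size_append]; omega)

lemma norm_sum_sq_le_mul_sum {ι : Type*} (s : Finset ι) {c : ℝ} (hc : 0 ≤ c) {z : ι → ℂ}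
    {x y : ι → ℝ} (hx : ∀ i ∈ s, 0 ≤ x i) (hy : ∀ i ∈ s, 0 ≤ y i)
    (h : ∀ i ∈ s, ‖z i‖ ^ 2 ≤ c * x i * y i) :
    ‖∑ i ∈ s, z i‖ ^ 2 ≤ c * (∑ i ∈ s, x i) * ∑ i ∈ s, y i := by
  refine (pow_le_pow_left₀ (norm_nonneg _) (norm_sum_le _ _) 2).trans ?_
  rw [Finset.mul_sum s x]
  exact Finset.sum_sq_le_sum_mul_sum_of_sq_le_mul s (fun i hi => mul_nonneg hc (hx i hi)) hy h

/-- Here `F` is excited on `[1, b]`, but only at the last three bonds, and `G` is a ground state of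
the last nine sites. -/
lemma norm_sum_tilings_sq_le (hb : b ≤ L) (hF : IsRelated L lam F 1 (b - 3))
    (hG : IsRelated L lam G (b - 8) b) (ho : IsExcited L b lam F) :
    ‖∑ T ∈ tilings L, star (G T) * F T‖ ^ 2
      ≤ f (‖lam‖ ^ 2) * (∑ T ∈ tilings L, ‖G T‖ ^ 2) * ∑ T ∈ tilings L, ‖F T‖ ^ 2 := by
  classical
  have hf := f_nonneg (r := ‖lam‖ ^ 2) (by positivity)
  obtain ⟨eq_zero, overlap_eq_zero⟩ := eq_zero_of_isExcited hb hF ho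
  have sum_eq : ∑ T ∈ tilings L with HasLastRun b T, star (G T) * F T
      = ∑ T ∈ tilings L, star (G T) * F T := by
    refine Finset.sum_filter_of_ne fun T hT => ?_
    contrapose!
    intro h
    rw [eq_zero T hT h, mul_zero]
  calc ‖∑ T ∈ tilings L, star (G T) * F T‖ ^ 2
      ≤ f (‖lam‖ ^ 2) * (∑ T ∈ tilings L with HasLastRun b T, ‖G T‖ ^ 2)
        * ∑ T ∈ tilings L with HasLastRun b T, ‖F T‖ ^ 2 := by
        rw [← sum_eq, sum_hasLastRun hb, sum_hasLastRun hb, sum_hasLastRun hb]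
        refine norm_sum_sq_le_mul_sum _ hf (fun _ _ => by positivity) (fun _ _ => by positivity) ?_
        rintro ⟨A, j, B⟩ hc
        exact norm_sum_runs_sq_le hb hF hG hc (overlap_eq_zero _ hc)
    _ ≤ _ := by gcongr <;> exact Finset.filter_subset _ _

end Overlap

end Projection

end LastRuns

/-! ### The martingale method -/

lemma one_sub_sqrt_mul_sum_sq_le {F : ℝ} (hF : F < 1 / 3) (s : Finset ℕ) (a b p : ℕ → ℝ)
    (h : ∀ n ∈ s, a n ^ 2 ≤ a n * (b n + √F * p n)) (hp : ∑ n ∈ s, p n ^ 2 ≤ 3 * ∑ n ∈ s, a n ^ 2) :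
    (1 - √(3 * F)) ^ 2 * ∑ n ∈ s, a n ^ 2 ≤ ∑ n ∈ s, b n ^ 2 := by
  set S := ∑ n ∈ s, a n ^ 2
  set B := ∑ n ∈ s, b n ^ 2
  have hS0 : 0 ≤ S := Finset.sum_nonneg fun _ _ => sq_nonneg _
  have hB0 : 0 ≤ B := Finset.sum_nonneg fun _ _ => sq_nonneg _
  have cauchy_schwarz : S ≤ √S * (√B + √(3 * F) * √S) :=
    calc S ≤ ∑ n ∈ s, a n * (b n + √F * p n) := Finset.sum_le_sum h
      _ = ∑ n ∈ s, a n * b n + √F * ∑ n ∈ s, a n * p n := by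
        rw [Finset.mul_sum, ← Finset.sum_add_distrib]
        exact Finset.sum_congr rfl fun n _ => by ring
      _ ≤ √S * √B + √F * (√S * √(3 * S)) := by
        gcongr
        · exact Real.sum_mul_le_sqrt_mul_sqrt s a b
        · exact (Real.sum_mul_le_sqrt_mul_sqrt s a p).trans (by gcongr)
      _ = √S * (√B + √(3 * F) * √S) := by
        rw [Real.sqrt_mul zero_le_three, Real.sqrt_mul zero_le_three]
        ring
  have root_bound : (1 - √(3 * F)) * √S ≤ √B := by
    rcases (Real.sqrt_nonneg S).eq_or_lt with h0 | h0
    · rw [← h0, mul_zero]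
      exact Real.sqrt_nonneg _
    · refine le_of_mul_le_mul_left ?_ h0
      linarith [Real.mul_self_sqrt hS0]
  have hF1 : √(3 * F) ≤ 1 := Real.sqrt_le_one.2 (by linarith)
  have := pow_le_pow_left₀ (mul_nonneg (sub_nonneg.2 hF1) (Real.sqrt_nonneg S)) root_bound 2
  rwa [mul_pow, Real.sq_sqrt hS0, Real.sq_sqrt hB0] at this

lemma sum_sub_add_three_le {s : ℕ → ℝ} (hs : Antitone s) (N : ℕ) :
    ∑ n ∈ Finset.range N, (s (n - 2) - s (n + 1)) ≤ 3 * (s 0 - s N) := by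
  have telescoped : ∑ n ∈ Finset.range N, (s (n - 2) - s (n + 1)) =
      (s 0 - s N) + (s 0 - s (N - 1)) + (s 0 - s (N - 2)) := by
    induction N with
    | zero => simp
    | succ N ih =>
      rw [Finset.sum_range_succ, ih, Nat.add_sub_cancel, show N + 1 - 2 = N - 1 by omega]
      ring
  linarith [hs (Nat.sub_le N 1), hs (Nat.sub_le N 2)]

section InnerProductSpace

variable {𝕜 E : Type*} [RCLike 𝕜] [NormedAddCommGroup E] [InnerProductSpace 𝕜 E]

lemma commute_apply {A B : E →L[𝕜] E} (h : Commute A B) (v : E) : A (B v) = B (A v) :=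
  DFunLike.congr_fun h.eq v

lemma commute_starProjection_of_isSymmetric {A : E →L[𝕜] E} (hA : A.toLinearMap.IsSymmetric)
    {W : Submodule 𝕜 E} [W.HasOrthogonalProjection] (hW : ∀ v ∈ W, A v ∈ W) :
    Commute A W.starProjection := by
  ext1 v
  refine (Submodule.eq_starProjection_of_mem_of_inner_eq_zero
    (hW _ (W.starProjection_apply_mem v)) fun w hw => ?_).symm
  change inner 𝕜 (A v - A (W.starProjection v)) w = 0
  rw [← map_sub]
  exact (hA _ w).trans (Submodule.starProjection_inner_eq_zero v _ (hW w hw))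

lemma commute_starProjection_of_le {U V : Submodule 𝕜 E} [U.HasOrthogonalProjection]
    [V.HasOrthogonalProjection] (h : V ≤ U) : Commute U.starProjection V.starProjection :=
  commute_starProjection_of_isSymmetric U.starProjection_isSymmetric fun _ hv =>
    (Submodule.starProjection_eq_self_iff.2 (h hv)).symm ▸ hv

lemma norm_starProjection_sub_sq {U V : Submodule 𝕜 E} [U.HasOrthogonalProjection]
    [V.HasOrthogonalProjection] (h : V ≤ U) (ψ : E) :
    ‖U.starProjection ψ - V.starProjection ψ‖ ^ 2 =
      ‖U.starProjection ψ‖ ^ 2 - ‖V.starProjection ψ‖ ^ 2 := by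
  have nested : V.starProjection (U.starProjection ψ) = V.starProjection ψ :=
    DFunLike.congr_fun (Submodule.starProjection_comp_starProjection_of_le h) ψ
  have pythagoras := V.norm_sq_eq_add_norm_sq_starProjection (U.starProjection ψ)
  rw [Submodule.starProjection_orthogonal_val, nested] at pythagoras
  linarith

lemma norm_increment_sq_le {U V V' K : Submodule 𝕜 E} [U.HasOrthogonalProjection]
    [V.HasOrthogonalProjection] [V'.HasOrthogonalProjection] [K.HasOrthogonalProjection]
    (hVU : V ≤ U) (hV : V' ≤ V) (hK : V' ≤ K) (hKU : Commute K.starProjection U.starProjection)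
    (ψ : E) :
    ‖V.starProjection ψ - V'.starProjection ψ‖ ^ 2 ≤
      ‖V.starProjection ψ - V'.starProjection ψ‖ * ‖ψ - K.starProjection ψ‖ +
        ‖K.starProjection (V.starProjection ψ - V'.starProjection ψ)‖ *
          ‖U.starProjection ψ - V'.starProjection ψ‖ := by
  set e := V.starProjection ψ - V'.starProjection ψ with he
  set p := U.starProjection ψ - V'.starProjection ψ with hp
  have he_mem : e ∈ V := V.sub_mem (V.starProjection_apply_mem ψ)
    (hV (V'.starProjection_apply_mem ψ))
  have he_left : inner 𝕜 e (ψ - V.starProjection ψ) = 0 :=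
    Submodule.inner_right_of_mem_orthogonal he_mem (V.sub_starProjection_mem_orthogonal ψ)
  have he_far : inner 𝕜 e (K.starProjection (ψ - U.starProjection ψ)) = 0 := by
    refine Submodule.inner_right_of_mem_orthogonal (hVU he_mem)
      (U.starProjection_apply_eq_zero_iff.1 ?_)
    rw [← commute_apply hKU, U.starProjection_apply_eq_zero_iff.2
      (U.sub_starProjection_mem_orthogonal ψ), map_zero]
  have decomposition : e = (ψ - K.starProjection ψ) + K.starProjection p +
      K.starProjection (ψ - U.starProjection ψ) - (ψ - V.starProjection ψ) := by
    have hK_fix := Submodule.starProjection_eq_self_iff.2 (hK (V'.starProjection_apply_mem ψ))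
    rw [he, hp, map_sub, map_sub, hK_fix]
    abel
  have inner_self : inner 𝕜 e e = inner 𝕜 e (ψ - K.starProjection ψ) +
      inner 𝕜 (K.starProjection e) p := by
    conv_lhs => rhs; rw [decomposition]
    rw [inner_sub_right, inner_add_right, inner_add_right, he_left, he_far, add_zero, sub_zero,
      Submodule.inner_starProjection_left_eq_right]
  calc ‖e‖ ^ 2 = ‖inner 𝕜 e e‖ := by simp [inner_self_eq_norm_sq_to_K]
    _ ≤ ‖inner 𝕜 e (ψ - K.starProjection ψ)‖ + ‖inner 𝕜 (K.starProjection e) p‖ :=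
      inner_self ▸ norm_add_le _ _
    _ ≤ ‖e‖ * ‖ψ - K.starProjection ψ‖ + ‖K.starProjection e‖ * ‖p‖ :=
      add_le_add (norm_inner_le_norm _ _) (norm_inner_le_norm _ _)

theorem martingale_method {W K : ℕ → Submodule 𝕜 E} [∀ n, (W n).HasOrthogonalProjection]
    [∀ n, (K n).HasOrthogonalProjection] (hW : Antitone W) (hW0 : W 0 = ⊤)
    (hWK : ∀ n, W (n + 1) ≤ K n)
    (hcomm : ∀ n, Commute (K (n + 2)).starProjection (W n).starProjection)
    {F : ℝ} (hF : F < 1 / 3) (N : ℕ) (ψ : E)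
    (hε : ∀ n < N,
      ‖(K n).starProjection ((W n).starProjection ψ - (W (n + 1)).starProjection ψ)‖ ^ 2
      ≤ F * ‖(W n).starProjection ψ - (W (n + 1)).starProjection ψ‖ ^ 2) :
    (1 - √(3 * F)) ^ 2 * (‖ψ‖ ^ 2 - ‖(W N).starProjection ψ‖ ^ 2) ≤
      ∑ n ∈ Finset.range N, ‖ψ - (K n).starProjection ψ‖ ^ 2 := by
  have norm_sub_sq {m n : ℕ} (h : m ≤ n) := norm_starProjection_sub_sq (hW h) ψ
  set s : ℕ → ℝ := fun n => ‖(W n).starProjection ψ‖ ^ 2 with hs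
  have hs_anti : Antitone s := fun m n h =>
    sub_nonneg.1 ((norm_sub_sq h).symm ▸ sq_nonneg _)
  have hs_zero : s 0 = ‖ψ‖ ^ 2 := by
    rw [hs]
    simp only [hW0, Submodule.starProjection_top, ContinuousLinearMap.id_apply]
  have sum_increments : ∑ n ∈ Finset.range N,
      ‖(W n).starProjection ψ - (W (n + 1)).starProjection ψ‖ ^ 2 = s 0 - s N := by
    simp only [norm_sub_sq (Nat.le_succ _)]
    exact Finset.sum_range_sub' s N
  rw [← hs_zero, ← sum_increments]
  refine one_sub_sqrt_mul_sum_sq_le hF _ _ _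
    (fun n => ‖(W (n - 2)).starProjection ψ - (W (n + 1)).starProjection ψ‖) (fun n hn => ?_) ?_
  · have hcomm' : Commute (K n).starProjection (W (n - 2)).starProjection := by
      rcases le_total n 2 with h | h
      · have hU : (W (n - 2)).starProjection = 1 := by
          simp only [Nat.sub_eq_zero_of_le h, hW0, Submodule.starProjection_top]
          rfl
        exact hU ▸ Commute.one_right _
      · simpa only [Nat.sub_add_cancel h] using hcomm (n - 2)
    have projected : ‖(K n).starProjection
        ((W n).starProjection ψ - (W (n + 1)).starProjection ψ)‖ ≤
        √F * ‖(W n).starProjection ψ - (W (n + 1)).starProjection ψ‖ := by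
      rw [← Real.sqrt_sq (norm_nonneg ((W n).starProjection ψ - _)),
        ← Real.sqrt_mul' _ (sq_nonneg _)]
      exact Real.le_sqrt_of_sq_le (hε n (Finset.mem_range.1 hn))
    refine (norm_increment_sq_le (hW (Nat.sub_le n 2)) (hW (Nat.le_succ n)) (hWK n) hcomm' ψ).trans
      ?_
    rw [mul_add, ← mul_assoc, mul_comm _ (√F)]
    gcongr
  · rw [sum_increments]
    rw [Finset.sum_congr rfl fun n _ => norm_sub_sq (show n - 2 ≤ n + 1 by omega)]
    exact sum_sub_add_three_le hs_anti N

end InnerProductSpace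

lemma ker_le_ker_of_le {E : Type*} [NormedAddCommGroup E] [InnerProductSpace ℂ E] [CompleteSpace E]
    {A B : E →L[ℂ] E} (hA : 0 ≤ A) (hAB : A ≤ B) :
    LinearMap.ker B.toLinearMap ≤ LinearMap.ker A.toLinearMap := by
  obtain ⟨C, rfl⟩ := CStarAlgebra.nonneg_iff_eq_star_mul_self.1 hA
  intro v (hv : B v = 0)
  have energy : inner ℂ (star C (C v)) v = ((‖C v‖ ^ 2 : ℝ) : ℂ) := by
    rw [ContinuousLinearMap.star_eq_adjoint, ContinuousLinearMap.adjoint_inner_left,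
      inner_self_eq_norm_sq_to_K, Complex.ofReal_pow]
    rfl
  have energy_le : 0 ≤ (inner ℂ (B v - star C (C v)) v).re :=
    ((ContinuousLinearMap.le_def _ _).1 hAB).re_inner_nonneg_left v
  rw [hv, zero_sub, inner_neg_left, energy, Complex.neg_re, Complex.ofReal_re, neg_nonneg]
    at energy_le
  have hCv : C v = 0 := by
    rw [← norm_eq_zero, ← sq_eq_zero_iff]
    exact energy_le.antisymm (sq_nonneg _)
  change star C (C v) = 0
  rw [hCv, map_zero]

/-! ### The martingale operators -/

lemma num_nonneg (x : ℕ) : 0 ≤ num L x := star_mul_self_nonneg _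

lemma num_mul_num_nonneg (x : ℕ) : 0 ≤ num L x * num L (x + 2) :=
  (commute_num (by omega)).mul_nonneg (num_nonneg x) (num_nonneg _)

lemma smul_star_q_mul_q_nonneg {κ : ℝ} (hκ : 0 ≤ κ) (lam : ℂ) (x : ℕ) :
    0 ≤ (κ : ℂ) • (star (q L lam x) * q L lam x) :=
  (ContinuousLinearMap.nonneg_iff_isPositive _).2
    (.smul_of_nonneg ((ContinuousLinearMap.nonneg_iff_isPositive _).1 (star_mul_self_nonneg _))
      (Complex.zero_le_real.2 hκ))

lemma ham_nonneg {κ : ℝ} (hκ : 0 ≤ κ) (lam : ℂ) (a b : ℕ) : 0 ≤ Ham L κ lam a b := by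
  refine add_nonneg (Finset.sum_nonneg fun x _ => num_mul_num_nonneg x) ?_
  · rw [Finset.smul_sum]
    exact Finset.sum_nonneg fun x _ => smul_star_q_mul_q_nonneg hκ lam x

lemma leftEnd_spec {k n : ℕ} (hk : 1 ≤ k ∧ k ≤ 3) (hn : 2 ≤ n) :
    1 ≤ leftEnd k n ∧ leftEnd k n + 3 ≤ 3 * n + k ∧ 3 * n + k ≤ leftEnd k n + 8 := by
  unfold leftEnd
  split_ifs <;> omega

section Windows

variable {M : Type*} [AddCommMonoid M] {k : ℕ} (hk : 1 ≤ k ∧ k ≤ 3)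

include hk

lemma sum_sum_windows_eq (N j : ℕ) (w : ℕ → M) :
    ∑ n ∈ Finset.Icc 2 N, ∑ x ∈ Finset.Icc (leftEnd k n) (3 * n + k - j), w x =
      ∑ x ∈ Finset.Icc 1 (3 * N + k - j),
        {n ∈ Finset.Icc 2 N | leftEnd k n ≤ x ∧ x ≤ 3 * n + k - j}.card • w x := by
  simp only [← Finset.sum_const]
  refine Finset.sum_comm' fun n x => ?_
  simp only [Finset.mem_Icc, Finset.mem_filter]
  constructor
  · rintro ⟨hn, hx⟩
    have := leftEnd_spec hk hn.1
    omega
  · rintro ⟨⟨hn, hx⟩, -⟩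
    exact ⟨hn, hx⟩

variable [PartialOrder M] [IsOrderedAddMonoid M] {w : ℕ → M} (hw : ∀ x, 0 ≤ w x)
include hw

lemma sum_le_sum_sum_windows {N j : ℕ} (hN : 2 ≤ N) (hj : j ≤ 6) :
    ∑ x ∈ Finset.Icc 1 (3 * N + k - j), w x ≤
      ∑ n ∈ Finset.Icc 2 N, ∑ x ∈ Finset.Icc (leftEnd k n) (3 * n + k - j), w x := by
  rw [sum_sum_windows_eq hk]
  refine Finset.sum_le_sum fun x hx => le_self_nsmul (hw x) (Finset.card_ne_zero.2 ?_)
  rw [Finset.mem_Icc] at hx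
  refine ⟨max 2 ((x + j + 2 - k) / 3), ?_⟩
  rw [Finset.mem_filter]
  simp only [Finset.mem_Icc, leftEnd]
  split_ifs <;> omega

lemma sum_sum_windows_le (N j : ℕ) :
    ∑ n ∈ Finset.Icc 2 N, ∑ x ∈ Finset.Icc (leftEnd k n) (3 * n + k - j), w x ≤
      3 • ∑ x ∈ Finset.Icc 1 (3 * N + k - j), w x := by
  rw [sum_sum_windows_eq hk, Finset.smul_sum]
  refine Finset.sum_le_sum fun x _ => nsmul_le_nsmul_left (hw x) ?_
  refine (Finset.card_le_card (t := Finset.Icc ((x + 2 - k) / 3) ((x + 2 - k) / 3 + 2)) ?_).trans ?_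
  · intro n hn
    rw [Finset.mem_filter] at hn
    simp only [Finset.mem_Icc, leftEnd] at hn ⊢
    split_ifs at hn <;> omega
  · simp only [Nat.card_Icc]
    omega

end Windows

section HSum

variable {κ : ℝ} (lam : ℂ) {k n m : ℕ} (hκ : 0 ≤ κ)

lemma hSum_eq_sum_windows : hSum L κ lam k n =
    ∑ m ∈ Finset.Icc 2 n, ∑ x ∈ Finset.Icc (leftEnd k m) (3 * m + k - 2),
        num L x * num L (x + 2) +
      ∑ m ∈ Finset.Icc 2 n, ∑ x ∈ Finset.Icc (leftEnd k m) (3 * m + k - 3),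
        (κ : ℂ) • (star (q L lam x) * q L lam x) := by
  simp only [hSum, hLoc, Ham, Finset.sum_add_distrib, Finset.smul_sum]

include hκ

lemma ham_le_hSum (hk : 1 ≤ k ∧ k ≤ 3) (hn : 2 ≤ n) :
    Ham L κ lam 1 (3 * n + k) ≤ hSum L κ lam k n := by
  rw [hSum_eq_sum_windows, Ham, Finset.smul_sum]
  refine add_le_add ?_ ?_
  · exact sum_le_sum_sum_windows hk num_mul_num_nonneg hn (by norm_num)
  · exact sum_le_sum_sum_windows hk (fun x => smul_star_q_mul_q_nonneg hκ lam x) hn (by norm_num)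

lemma hSum_le_ham (hk : 1 ≤ k ∧ k ≤ 3) :
    hSum L κ lam k n ≤ 3 • Ham L κ lam 1 (3 * n + k) := by
  rw [hSum_eq_sum_windows, Ham, Finset.smul_sum, smul_add]
  refine add_le_add ?_ ?_
  · exact sum_sum_windows_le hk num_mul_num_nonneg _ _
  · exact sum_sum_windows_le hk (fun x => smul_star_q_mul_q_nonneg hκ lam x) _ _

lemma hLoc_le_hSum (hn : 2 ≤ n) (hnm : n ≤ m) : hLoc L κ lam k n ≤ hSum L κ lam k m :=
  Finset.single_le_sum (f := hLoc L κ lam k) (fun _ _ => ham_nonneg hκ lam _ _)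
    (Finset.mem_Icc.2 ⟨hn, hnm⟩)

lemma hSum_mono : Monotone (hSum L κ lam k) := fun _ _ h =>
  Finset.sum_le_sum_of_subset_of_nonneg (Finset.Icc_subset_Icc_right h)
    fun _ _ _ => ham_nonneg hκ lam _ _

lemma hSum_nonneg : 0 ≤ hSum L κ lam k n :=
  Finset.sum_nonneg fun _ _ => ham_nonneg hκ lam _ _

end HSum

/-! ### Projections onto kernels and the tiling space -/

section KerProj

variable {A B : Op L}

lemma isSymmetric_of_nonneg (hA : 0 ≤ A) : A.toLinearMap.IsSymmetric :=
  ((ContinuousLinearMap.nonneg_iff_isPositive A).1 hA).isSymmetric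

lemma isSymmetric_kerProj (A : Op L) : (kerProj A).toLinearMap.IsSymmetric :=
  Submodule.starProjection_isSymmetric _

lemma apply_kerProj (A : Op L) (ψ : Hilb L) : A (kerProj A ψ) = 0 :=
  Submodule.starProjection_apply_mem (LinearMap.ker A.toLinearMap) ψ

lemma norm_sub_kerProj_le (ψ : Hilb L) {χ : Hilb L} (hχ : A χ = 0) :
    ‖ψ - kerProj A ψ‖ ≤ ‖ψ - χ‖ := by
  rw [kerProj, Submodule.starProjection_minimal]
  exact ciInf_le ⟨0, Set.forall_mem_range.2 fun _ => norm_nonneg _⟩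
    (⟨χ, hχ⟩ : LinearMap.ker A.toLinearMap)

lemma norm_inner_kerProj_self (A : Op L) (ψ : Hilb L) :
    ‖inner ℂ (kerProj A ψ) ψ‖ = ‖kerProj A ψ‖ ^ 2 := by
  have fixed : kerProj A (kerProj A ψ) = kerProj A ψ :=
    Submodule.starProjection_eq_self_iff.2 (apply_kerProj A ψ)
  have symmetric : inner ℂ (kerProj A (kerProj A ψ)) ψ = inner ℂ (kerProj A ψ) (kerProj A ψ) :=
    isSymmetric_kerProj A _ _
  rw [← fixed, symmetric, fixed, inner_self_eq_norm_sq_to_K]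
  simp

lemma re_inner_one_sub_kerProj_self (A : Op L) (ψ : Hilb L) :
    (inner ℂ ψ ((1 - kerProj A) ψ)).re = ‖ψ - kerProj A ψ‖ ^ 2 := by
  have orthogonal : inner ℂ (kerProj A ψ) (ψ - kerProj A ψ) = 0 :=
    Submodule.inner_right_of_mem_orthogonal (apply_kerProj A ψ)
      (Submodule.sub_starProjection_mem_orthogonal ψ)
  calc (inner ℂ ψ ((1 - kerProj A) ψ)).re
      = (inner ℂ (ψ - kerProj A ψ) (ψ - kerProj A ψ)).re := by
        rw [inner_sub_left, orthogonal, sub_zero, sub_apply, one_apply_eq_self]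
    _ = ‖ψ - kerProj A ψ‖ ^ 2 := inner_self_eq_norm_sq (𝕜 := ℂ) _

lemma commute_kerProj (hA : A.toLinearMap.IsSymmetric) (h : Commute A B) :
    Commute A (kerProj B) :=
  commute_starProjection_of_isSymmetric hA fun v (hv : B v = 0) => by
    change B (A v) = 0
    rw [← commute_apply h, hv, map_zero]

lemma commute_kerProj_kerProj (hA : A.toLinearMap.IsSymmetric) (h : Commute A B) :
    Commute (kerProj A) (kerProj B) :=
  (commute_kerProj (isSymmetric_kerProj B) (commute_kerProj hA h).symm).symm

/-- `A` commutes with the orthogonal projection onto the tiling space, that is, both the tiling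
space and its orthogonal complement are invariant under `A`. -/
def Reduces (A : Op L) : Prop := Commute A (tilingSpace L).starProjection

lemma LeavesInvariant.reduces (hA : A.toLinearMap.IsSymmetric) (h : LeavesInvariant A) :
    Reduces A :=
  commute_starProjection_of_isSymmetric hA h

lemma Reduces.leavesInvariant (h : Reduces A) : LeavesInvariant A := fun ψ hψ => by
  rw [← Submodule.starProjection_eq_self_iff.2 hψ, commute_apply h]
  exact Submodule.starProjection_apply_mem _ _

lemma Reduces.kerProj (h : Reduces A) : Reduces (kerProj A) :=
  (commute_kerProj (Submodule.starProjection_isSymmetric _) h.symm).symm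

lemma restr_mul_restr (B : Op L) (h : Reduces A) : restr A * restr B = restr (A * B) := by
  have hP := (tilingSpace L).isIdempotentElem_starProjection.eq
  calc restr A * restr B
      = (tilingSpace L).starProjection * (A * (tilingSpace L).starProjection) *
        ((tilingSpace L).starProjection * B * (tilingSpace L).starProjection) := by
        simp only [restr, mul_assoc]
    _ = restr (A * B) := by
        rw [h.eq]
        simp only [restr, ← mul_assoc, hP]
        rw [mul_assoc _ A, h.eq, ← mul_assoc, hP]

lemma commute_restr (hA : Reduces A) (hB : Reduces B) (h : Commute A B) :
    Commute (restr A) (restr B) := by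
  rw [Commute, SemiconjBy, restr_mul_restr _ hA, restr_mul_restr _ hB, h.eq]

lemma inner_restr (A : Op L) (u v : Hilb L) : inner ℂ u (restr A v) =
    inner ℂ ((tilingSpace L).starProjection u) (A ((tilingSpace L).starProjection v)) :=
  (Submodule.inner_starProjection_left_eq_right _ _ _).symm

lemma restr_le_restr (hA : A.toLinearMap.IsSymmetric) (hB : B.toLinearMap.IsSymmetric)
    (h : ∀ ψ ∈ tilingSpace L, (inner ℂ ψ (A ψ)).re ≤ (inner ℂ ψ (B ψ)).re) :
    restr A ≤ restr B := by
  have restr_sub : restr B - restr A = restr (B - A) := by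
    simp only [restr, mul_sub, sub_mul]
  have selfAdjoint : IsSelfAdjoint (restr (B - A)) :=
    (hB.isSelfAdjoint.sub hA.isSelfAdjoint).conj_starProjection _
  rw [ContinuousLinearMap.le_def, restr_sub, ContinuousLinearMap.isPositive_def']
  refine ⟨selfAdjoint, fun v => ?_⟩
  rw [ContinuousLinearMap.reApplyInnerSelf_apply, inner_re_symm, inner_restr, sub_apply,
    inner_sub_right, map_sub]
  exact sub_nonneg.2 (h _ (Submodule.starProjection_apply_mem _ v))

lemma smul_restr (c : ℂ) (A : Op L) : c • restr A = restr (c • A) := by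
  simp only [restr, mul_smul_comm, smul_mul_assoc]

end KerProj

section Hamiltonians

variable {κ : ℝ} (lam : ℂ) {k n m N : ℕ}

lemma leavesInvariant_ham (κ : ℝ) {a b : ℕ} (hL : 5 ≤ L) (ha : 1 ≤ a) (hab : a + 3 ≤ b)
    (hb : b ≤ L) : LeavesInvariant (Ham L κ lam a b) := fun _ hψ =>
  ham_mem_tilingSpace κ lam hL ha hab hb hψ

lemma commute_hLoc_hSum (κ : ℝ) (hk : 1 ≤ k ∧ k ≤ 3) (h : m + 3 ≤ n) :
    Commute (hLoc L κ lam k n) (hSum L κ lam k m) :=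
  Commute.sum_right _ _ _ fun j hj => by
    rw [Finset.mem_Icc] at hj
    refine (commute_ham_of_disjoint (leftEnd_spec hk hj.1).2.1
      (leftEnd_spec hk (by omega)).2.1 ?_).symm
    rw [leftEnd, if_neg (by omega)]
    omega

lemma hSum_two (κ : ℝ) : hSum L κ lam k 2 = hLoc L κ lam k 2 := by
  simp [hSum]

lemma GProj_one (κ : ℝ) : GProj L κ lam k 1 = 1 := by
  ext1 ψ
  exact Submodule.starProjection_eq_self_iff.2 (show hSum L κ lam k 1 ψ = 0 from rfl)

lemma EProj_of_lt (κ : ℝ) (hn : 1 ≤ n) (hnN : n < N) :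
    EProj L κ lam N k n = GProj L κ lam k n - GProj L κ lam k (n + 1) := by
  rcases hn.eq_or_lt with rfl | h
  · rw [GProj_one, EProj, if_pos rfl]
  · rw [EProj, if_neg h.ne', if_pos hnN]

lemma EProj_self (κ : ℝ) (hN : 2 ≤ N) : EProj L κ lam N k N = GProj L κ lam k N := by
  rw [EProj, if_neg (by omega), if_neg (lt_irrefl N)]

variable (hκ : 0 ≤ κ)
include hκ

lemma ker_hSum_antitone : Antitone fun n => LinearMap.ker (hSum L κ lam k n).toLinearMap :=
  fun _ _ h => ker_le_ker_of_le (hSum_nonneg lam hκ) (hSum_mono lam hκ h)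

lemma ker_hSum_le_ker_hLoc (hn : 2 ≤ n) (hnm : n ≤ m) :
    LinearMap.ker (hSum L κ lam k m).toLinearMap ≤ LinearMap.ker (hLoc L κ lam k n).toLinearMap :=
  ker_le_ker_of_le (ham_nonneg hκ lam _ _) (hLoc_le_hSum lam hκ hn hnm)

lemma ker_hSum (hk : 1 ≤ k ∧ k ≤ 3) (hn : 2 ≤ n) :
    LinearMap.ker (hSum L κ lam k n).toLinearMap =
      LinearMap.ker (Ham L κ lam 1 (3 * n + k)).toLinearMap := by
  refine le_antisymm (ker_le_ker_of_le (ham_nonneg hκ lam _ _) (ham_le_hSum lam hκ hk hn)) ?_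
  refine le_trans (fun ψ (hψ : Ham L κ lam 1 (3 * n + k) ψ = 0) => ?_)
    (ker_le_ker_of_le (hSum_nonneg lam hκ) (hSum_le_ham lam hκ hk))
  change 3 • Ham L κ lam 1 (3 * n + k) ψ = 0
  rw [hψ, smul_zero]

lemma commute_gProj_GProj (hk : 1 ≤ k ∧ k ≤ 3) (hn : 2 ≤ n) (h : n ≤ m ∨ m + 3 ≤ n) :
    Commute (gProj L κ lam k n) (GProj L κ lam k m) := by
  rcases h with h | h
  · exact commute_starProjection_of_le (ker_hSum_le_ker_hLoc lam hκ hn h)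
  · exact commute_kerProj_kerProj (isSymmetric_of_nonneg (ham_nonneg hκ lam _ _))
      (commute_hLoc_hSum lam κ hk h)

lemma commute_gProj_EProj (hk : 1 ≤ k ∧ k ≤ 3) (hn : 2 ≤ n) (hnN : n ≤ N) (hm : 1 ≤ m)
    (hmN : m ≤ N) (h : n ≤ m ∨ m + 4 ≤ n) :
    Commute (gProj L κ lam k n) (EProj L κ lam N k m) := by
  rcases hmN.eq_or_lt with rfl | hmN
  · rw [EProj_self lam κ (hn.trans hnN)]
    exact commute_gProj_GProj lam hκ hk hn (.inl hnN)
  · rw [EProj_of_lt lam κ hm hmN]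
    exact (commute_gProj_GProj lam hκ hk hn (by omega)).sub_right
      (commute_gProj_GProj lam hκ hk hn (by omega))

section Reduces

variable (hk : 1 ≤ k ∧ k ≤ 3)
include hk

lemma reduces_hLoc (hn : 2 ≤ n) (hnL : 3 * n + k ≤ L) : Reduces (hLoc L κ lam k n) := by
  obtain ⟨hl, hlr, -⟩ := leftEnd_spec hk hn
  exact (leavesInvariant_ham lam κ (by omega) hl hlr hnL).reduces
    (isSymmetric_of_nonneg (ham_nonneg hκ lam _ _))

lemma reduces_hSum (hnL : 3 * n + k ≤ L) : Reduces (hSum L κ lam k n) :=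
  Commute.sum_left _ _ _ fun j hj => by
    rw [Finset.mem_Icc] at hj
    exact reduces_hLoc lam hκ hk hj.1 (by omega)

lemma reduces_EProj (hm : 1 ≤ m) (hN : 2 ≤ N) (hmN : m ≤ N) (hNL : 3 * N + k ≤ L) :
    Reduces (EProj L κ lam N k m) := by
  rcases hmN.eq_or_lt with rfl | hmN
  · rw [EProj_self lam κ hN]
    exact (reduces_hSum lam hκ hk hNL).kerProj
  · rw [EProj_of_lt lam κ hm hmN]
    exact Commute.sub_left (reduces_hSum lam hκ hk (by omega)).kerProj
      (reduces_hSum lam hκ hk (by omega)).kerProj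

end Reduces

end Hamiltonians

/-! ### Ground states of the local Hamiltonians and the spectral gap -/

lemma conf_replicate_void (n : ℕ) : conf (List.replicate n .V) = List.replicate n false := by
  induction n with
  | zero => rfl
  | succ n ih => rw [List.replicate_succ, conf_cons, ih]; rfl

lemma isPadded_dimer_voids (hL : 3 ≤ L) :
    IsPadded L ([.V] ++ .D :: List.replicate (L - 3) .V) := by
  have commute_voids : List.replicate 3 false ++ List.replicate (L - 3) false =
      List.replicate (L - 3) false ++ List.replicate 3 false := by
    rw [List.replicate_append_replicate, List.replicate_append_replicate, add_comm]
  refine .of_conf_eq (w := [false, true, true] ++ List.replicate (L - 3) false) ?_ ?_ ?_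
  · simp +contextual [Tile.IsBulk]
  · simp only [List.length_append, List.length_cons, List.length_nil, List.length_replicate]
    omega
  · simp only [conf_append, conf_cons, conf_replicate_void]
    exact congrArg ([false, false, true, true] ++ ·) commute_voids
  

section Gap

variable {κ : ℝ} (lam : ℂ) {k n N : ℕ} (hκ : 0 < κ) (hk : 1 ≤ k ∧ k ≤ 3)
include hκ hk

lemma mul_norm_sub_gProj_sq_le (hn : 2 ≤ n) (hnL : 3 * n + k ≤ L) {ψ : Hilb L}
    (hψ : ψ ∈ tilingSpace L) :
    κ * ‖ψ - gProj L κ lam k n ψ‖ ^ 2 ≤ (inner ℂ ψ (hLoc L κ lam k n ψ)).re := by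
  obtain ⟨hl, hlr, hrl⟩ := leftEnd_spec hk hn
  obtain ⟨χ, hχ, hle⟩ :=
    exists_ham_eq_zero_mul_norm_sub_sq_le lam hκ (by omega) hl hlr hrl hnL hψ
  refine le_trans ?_ hle
  gcongr
  exact norm_sub_kerProj_le ψ hχ

lemma smul_restr_one_sub_gProj_le (hn : 2 ≤ n) (hnL : 3 * n + k ≤ L) :
    κ • restr (1 - gProj L κ lam k n) ≤ restr (hLoc L κ lam k n) := by
  have symm_left : ((κ : ℂ) • (1 - gProj L κ lam k n)).toLinearMap.IsSymmetric :=
    (LinearMap.IsSymmetric.id.sub (isSymmetric_kerProj _)).smul (Complex.conj_ofReal κ)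
  have symm_right := isSymmetric_of_nonneg
    (ham_nonneg (L := L) hκ.le lam (leftEnd k n) (3 * n + k))
  change (κ : ℂ) • restr (1 - gProj L κ lam k n) ≤ _
  rw [smul_restr]
  refine restr_le_restr symm_left symm_right fun ψ hψ => ?_
  calc (inner ℂ ψ (((κ : ℂ) • (1 - gProj L κ lam k n)) ψ)).re
      = κ * ‖ψ - gProj L κ lam k n ψ‖ ^ 2 := by
        rw [smul_apply, inner_smul_right, Complex.re_ofReal_mul, gProj,
          re_inner_one_sub_kerProj_self]
    _ ≤ (inner ℂ ψ (hLoc L κ lam k n ψ)).re := mul_norm_sub_gProj_sq_le lam hκ hk hn hnL hψ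

lemma hSum_apply_eq_zero_iff (hn : 2 ≤ n) (ψ : Hilb L) :
    hSum L κ lam k n ψ = 0 ↔ Ham L κ lam 1 (3 * n + k) ψ = 0 :=
  SetLike.ext_iff.1 (ker_hSum lam hκ.le hk hn) ψ

lemma isExcited_of_GProj_eq_zero (hn : 2 ≤ n) (hnL : 3 * n + k ≤ L) {φ : Hilb L}
    (hφ : φ ∈ tilingSpace L) (h : GProj L κ lam k n φ = 0) :
    IsExcited L (3 * n + k) lam fun T => φ (cfg L T) := fun G hG => by
  have hL : 5 ≤ L := by omega
  have ground_state : hSum L κ lam k n (tilingVec L G) = 0 := by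
    rw [hSum_apply_eq_zero_iff lam hκ hk hn, ham_eq_zero_iff_isRelated κ lam hL le_rfl (by omega)
      hnL (tilingVec_mem_tilingSpace hL G) hκ]
    intro X Y hD ha hb
    have hMM := (isPadded_monomers_iff ha (by omega) rfl).2 hD
    simp only [tilingVec_apply G hD, tilingVec_apply G hMM]
    exact hG X Y hD ha hb
  have orthogonal : inner ℂ (tilingVec L G) φ = 0 :=
    Submodule.inner_right_of_mem_orthogonal ground_state
      ((Submodule.starProjection_apply_eq_zero_iff _).1 h)
  rw [← orthogonal, inner_eq_sum_tilings hL _ hφ]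
  refine Finset.sum_congr rfl fun T hT => ?_
  rw [tilingVec_apply G (mem_tilings.1 hT)]

lemma norm_gProj_sq_le (hn : 2 ≤ n) (hnL : 3 * (n + 1) + k ≤ L) {φ : Hilb L}
    (hφ : φ ∈ tilingSpace L) (hφn : hSum L κ lam k n φ = 0)
    (hφn' : GProj L κ lam k (n + 1) φ = 0) :
    ‖gProj L κ lam k (n + 1) φ‖ ^ 2 ≤ f (‖lam‖ ^ 2) * ‖φ‖ ^ 2 := by
  have hL : 5 ≤ L := by omega
  have hf := f_nonneg (r := ‖lam‖ ^ 2) (by positivity)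
  have hgφ : gProj L κ lam k (n + 1) φ ∈ tilingSpace L :=
    (reduces_hLoc lam hκ.le hk (by omega) hnL).kerProj.leavesInvariant φ hφ
  have related_left := (ham_eq_zero_iff_isRelated κ lam hL le_rfl (by omega) (by omega) hφ hκ).1
    ((hSum_apply_eq_zero_iff lam hκ hk hn φ).1 hφn)
  obtain ⟨hl, hlr, -⟩ := leftEnd_spec hk (show 2 ≤ n + 1 by omega)
  have related_right := (ham_eq_zero_iff_isRelated κ lam hL hl hlr hnL hgφ hκ).1
    (apply_kerProj (hLoc L κ lam k (n + 1)) φ)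
  rw [leftEnd, if_neg (by omega)] at related_right
  have key := norm_sum_tilings_sq_le hnL
    (by rwa [show 3 * (n + 1) + k - 3 = 3 * n + k by omega]) related_right
    (isExcited_of_GProj_eq_zero lam hκ hk (by omega) hnL hφ hφn')
  rw [← inner_eq_sum_tilings hL _ hφ, ← norm_sq_eq_sum_tilings hL hφ,
    ← norm_sq_eq_sum_tilings hL hgφ, gProj, norm_inner_kerProj_self] at key
  rcases (sq_nonneg ‖gProj L κ lam k (n + 1) φ‖).eq_or_lt with h0 | h0
  · rw [← h0]
    positivity
  · refine le_of_mul_le_mul_left ?_ h0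
    rw [gProj]
    linarith

lemma norm_gProj_increment_sq_le (hn : 1 ≤ n) (hnL : 3 * (n + 1) + k ≤ L) {ψ : Hilb L}
    (hψ : ψ ∈ tilingSpace L) :
    ‖gProj L κ lam k (n + 1) (GProj L κ lam k n ψ - GProj L κ lam k (n + 1) ψ)‖ ^ 2 ≤
      f (‖lam‖ ^ 2) * ‖GProj L κ lam k n ψ - GProj L κ lam k (n + 1) ψ‖ ^ 2 := by
  have hker := ker_hSum_antitone (L := L) (k := k) lam hκ.le n.le_succ
  have GProj_increment : GProj L κ lam k (n + 1)
      (GProj L κ lam k n ψ - GProj L κ lam k (n + 1) ψ) = 0 := by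
    have nested := Submodule.starProjection_comp_starProjection_of_le hker
    have idempotent := Submodule.starProjection_comp_starProjection_of_le
      (le_refl (LinearMap.ker (hSum L κ lam k (n + 1)).toLinearMap))
    rw [map_sub, sub_eq_zero]
    exact (DFunLike.congr_fun nested ψ).trans (DFunLike.congr_fun idempotent ψ).symm
  rcases hn.eq_or_lt with rfl | hn
  · rw [gProj, ← hSum_two, ← GProj, GProj_increment, norm_zero, zero_pow two_ne_zero]
    have hf := f_nonneg (r := ‖lam‖ ^ 2) (by positivity)
    positivity
  · refine norm_gProj_sq_le lam hκ hk hn hnL ?_ ?_ GProj_increment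
    · exact sub_mem ((reduces_hSum lam hκ.le hk (by omega)).kerProj.leavesInvariant ψ hψ)
        ((reduces_hSum lam hκ.le hk hnL).kerProj.leavesInvariant ψ hψ)
    · rw [map_sub, GProj, apply_kerProj, zero_sub, neg_eq_zero]
      exact hker (apply_kerProj _ ψ)

lemma norm_restr_gProj_mul_restr_EProj_sq_le (hn : 2 ≤ n) (hnN : n ≤ N) (hNL : 3 * N + k ≤ L) :
    ‖restr (gProj L κ lam k n) * restr (EProj L κ lam N k (n - 1))‖ ^ 2 ≤ f (‖lam‖ ^ 2) := by
  obtain ⟨m, rfl⟩ : ∃ m, n = m + 1 := ⟨n - 1, by omega⟩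
  have hf := f_nonneg (r := ‖lam‖ ^ 2) (by positivity)
  set P := (tilingSpace L).starProjection
  set E := EProj L κ lam N k m
  have hE : E = GProj L κ lam k m - GProj L κ lam k (m + 1) :=
    EProj_of_lt lam κ (by omega) (by omega)
  have hg : Reduces (gProj L κ lam k (m + 1)) := (reduces_hLoc lam hκ.le hk hn (by omega)).kerProj
  have norm_E_le (φ : Hilb L) : ‖E φ‖ ≤ ‖φ‖ := by
    have pythagoras := norm_starProjection_sub_sq
      (ker_hSum_antitone (L := L) (k := k) lam hκ.le m.le_succ) φ
    have le_norm : ‖GProj L κ lam k m φ‖ ≤ ‖φ‖ := Submodule.norm_starProjection_apply_le _ φ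
    refine (le_of_sq_le_sq ?_ (norm_nonneg _)).trans le_norm
    rw [hE]
    exact pythagoras.trans_le (sub_le_self _ (sq_nonneg _))
  refine (pow_le_pow_left₀ (norm_nonneg _) (ContinuousLinearMap.opNorm_le_bound _
    (Real.sqrt_nonneg (f (‖lam‖ ^ 2))) fun ψ => ?_) 2).trans_eq (Real.sq_sqrt hf)
  rw [Nat.add_sub_cancel, restr_mul_restr _ hg]
  calc ‖P (gProj L κ lam k (m + 1) (E (P ψ)))‖
      ≤ ‖gProj L κ lam k (m + 1) (E (P ψ))‖ := Submodule.norm_starProjection_apply_le _ _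
    _ ≤ √(f (‖lam‖ ^ 2) * ‖E (P ψ)‖ ^ 2) := by
      rw [hE]
      exact Real.le_sqrt_of_sq_le (norm_gProj_increment_sq_le lam hκ hk (by omega) (by omega)
        (Submodule.starProjection_apply_mem _ ψ))
    _ = √(f (‖lam‖ ^ 2)) * ‖E (P ψ)‖ := by
      rw [Real.sqrt_mul hf, Real.sqrt_sq (norm_nonneg _)]
    _ ≤ √(f (‖lam‖ ^ 2)) * ‖ψ‖ := by
      gcongr
      exact (norm_E_le _).trans (Submodule.norm_starProjection_apply_le _ ψ)

lemma sum_hLoc_le_ham (ψ : Hilb L) :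
    ∑ n ∈ Finset.Icc 2 N, (inner ℂ ψ (hLoc L κ lam k n ψ)).re ≤
      3 * (inner ℂ ψ (Ham L κ lam 1 (3 * N + k) ψ)).re := by
  have energy_le := ((ContinuousLinearMap.le_def _ _).1
    (hSum_le_ham (L := L) (n := N) lam hκ.le hk)).re_inner_nonneg_right ψ
  simp only [sub_apply, inner_sub_right, map_sub, sub_nonneg, hSum, sum_apply, inner_sum, map_sum]
    at energy_le
  refine energy_le.trans_eq ?_
  rw [smul_apply, ← Nat.cast_smul_eq_nsmul ℂ, inner_smul_right, Nat.cast_ofNat]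
  exact Complex.re_ofReal_mul 3 _

lemma gap_estimate (hL : L = 3 * N + k) (hN : 2 ≤ N) (hf : f (‖lam‖ ^ 2) < 1 / 3) {ψ : Hilb L}
    (hψ : ψ ∈ tilingSpace L) (hψ' : ψ ∈ (LinearMap.ker (Ham L κ lam 1 L).toLinearMap)ᗮ) :
    κ / 3 * (1 - √(3 * f (‖lam‖ ^ 2))) ^ 2 * ‖ψ‖ ^ 2 ≤ (inner ℂ ψ (Ham L κ lam 1 L ψ)).re := by
  set W : ℕ → Submodule ℂ (Hilb L) :=
    fun n => LinearMap.ker (hSum L κ lam k (n + 1)).toLinearMap with hW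
  set K : ℕ → Submodule ℂ (Hilb L) :=
    fun n => LinearMap.ker (hLoc L κ lam k (n + 2)).toLinearMap
  have ground_component : (W (N - 1)).starProjection ψ = 0 := by
    rw [Submodule.starProjection_apply_eq_zero_iff, hW]
    simp only [Nat.sub_add_cancel (by omega : 1 ≤ N)]
    rwa [ker_hSum lam hκ.le hk hN, ← hL]
  have martingale := martingale_method (W := W) (K := K)
    (fun _ _ h => ker_hSum_antitone lam hκ.le (Nat.succ_le_succ h)) LinearMap.ker_zero
    (fun n => ker_hSum_le_ker_hLoc lam hκ.le (by omega) le_rfl)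
    (fun n => commute_gProj_GProj lam hκ.le hk (by omega) (.inr le_rfl)) hf (N - 1) ψ
    fun n hn => norm_gProj_increment_sq_le lam hκ hk (by omega) (by omega) hψ
  rw [ground_component, norm_zero, zero_pow two_ne_zero, sub_zero] at martingale
  have local_gaps : κ * ∑ n ∈ Finset.range (N - 1), ‖ψ - (K n).starProjection ψ‖ ^ 2 ≤
      ∑ n ∈ Finset.Icc 2 N, (inner ℂ ψ (hLoc L κ lam k n ψ)).re := by
    have reindex : Finset.Icc 2 N = (Finset.range (N - 1)).map (addRightEmbedding 2) := by
      rw [Finset.range_eq_Ico, Finset.map_add_right_Ico]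
      ext n
      simp only [Finset.mem_Icc, Finset.mem_Ico]
      omega
    rw [Finset.mul_sum, reindex, Finset.sum_map]
    refine Finset.sum_le_sum fun n hn => ?_
    rw [Finset.mem_range] at hn
    exact mul_norm_sub_gProj_sq_le lam hκ hk (by omega) (by omega) hψ
  have energy_le := sum_hLoc_le_ham (N := N) lam hκ hk ψ
  rw [← hL] at energy_le
  linarith [mul_le_mul_of_nonneg_left martingale hκ.le]

omit hk in
lemma exists_excited_state (hL : 5 ≤ L) :
    ∃ ψ ∈ tilingSpace L ⊓ (LinearMap.ker (Ham L κ lam 1 L).toLinearMap)ᗮ, ψ ≠ 0 := by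
  set H := Ham L κ lam 1 L
  have hLeaves : LeavesInvariant H := leavesInvariant_ham lam κ hL le_rfl (by omega) le_rfl
  have hH : Reduces H := hLeaves.reduces (isSymmetric_of_nonneg (ham_nonneg hκ.le lam 1 L))
  set Y : List Tile := List.replicate (L - 3) .V
  have padded : IsPadded L ([.V] ++ .D :: Y) := isPadded_dimer_voids (by omega)
  set v := tilingVec L fun T => dimerCount T
  have hv : v ∈ tilingSpace L := tilingVec_mem_tilingSpace hL _
  have not_ground : H v ≠ 0 := fun h => by
    have related := (ham_eq_zero_iff_isRelated κ lam hL le_rfl (by omega) le_rfl hv hκ).1 h [.V] Y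
      padded le_rfl (show 1 + 3 ≤ L by omega)
    have padded' := (isPadded_monomers_iff le_rfl (show 1 + 3 ≤ L by omega) rfl).2 padded
    simp only [v, tilingVec_apply _ padded, tilingVec_apply _ padded'] at related
    simp [dimerCount, Tile.dimers, Y] at related
  refine ⟨v - kerProj H v, ⟨sub_mem hv (hH.kerProj.leavesInvariant v hv),
    Submodule.sub_starProjection_mem_orthogonal v⟩, fun h => not_ground ?_⟩
  rw [sub_eq_zero.1 h]
  exact apply_kerProj H v

lemma le_E1 (hL : L = 3 * N + k) (hN : 2 ≤ N) (hf : f (‖lam‖ ^ 2) < 1 / 3) :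
    κ / 3 * (1 - √(3 * f (‖lam‖ ^ 2))) ^ 2 ≤ E1 L κ lam := by
  obtain ⟨φ, hφ, hφ0⟩ := exists_excited_state (L := L) lam hκ (by omega)
  refine le_csInf ⟨_, φ, hφ, hφ0, rfl⟩ ?_
  rintro _ ⟨ψ, ⟨hψ, hψ'⟩, hψ0, rfl⟩
  rw [le_div_iff₀ (by positivity)]
  exact gap_estimate lam hκ hk hL hN hf hψ hψ'

end Gap

end

end FQH

theorem theorem3p1 (κ : ℝ) (hκ : 0 < κ) (lam : ℂ) (L N k : ℕ) (hL : 10 ≤ L)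
    (hk : 1 ≤ k ∧ k ≤ 3) (hLN : L = 3 * N + k) :
    -- the tiling space is invariant, so that the restrictions make sense
    FQH.LeavesInvariant (FQH.Ham L κ lam 1 L) ∧
    (∀ n, 2 ≤ n → n ≤ N →
      FQH.LeavesInvariant (FQH.hLoc L κ lam k n) ∧
      FQH.LeavesInvariant (FQH.hSum L κ lam k n) ∧
      FQH.LeavesInvariant (FQH.gProj L κ lam k n)) ∧
    (∀ m, 1 ≤ m → m ≤ N → FQH.LeavesInvariant (FQH.EProj L κ lam N k m)) ∧
    -- the ratios in the definition of `f`
    (∀ n, 1 ≤ n →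
      ‖FQH.phi lam (n - 1)‖ ^ 2 / ‖FQH.phi lam n‖ ^ 2 = FQH.beta (‖lam‖ ^ 2) n) ∧
    -- the supremum defining `f` is finite
    BddAbove ((fun j => FQH.fk j (‖lam‖ ^ 2)) '' Set.Ici 4) ∧
    -- the three properties
    (∀ n, 2 ≤ n → n ≤ N →
      κ • FQH.restr (1 - FQH.gProj L κ lam k n) ≤ FQH.restr (FQH.hLoc L κ lam k n) ∧
      (∀ m, 1 ≤ m → m ≤ N →
        FQH.restr (FQH.gProj L κ lam k n) * FQH.restr (FQH.EProj L κ lam N k m)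
          - FQH.restr (FQH.EProj L κ lam N k m) * FQH.restr (FQH.gProj L κ lam k n) ≠ 0 →
        n ≤ m + 3 ∧ m + 1 ≤ n) ∧
      (lam ≠ 0 →
        ‖FQH.restr (FQH.gProj L κ lam k n) * FQH.restr (FQH.EProj L κ lam N k (n - 1))‖ ^ 2
          ≤ FQH.f (‖lam‖ ^ 2))) ∧
    -- the gap bound
    (lam ≠ 0 → FQH.f (‖lam‖ ^ 2) < 1 / 3 →
      κ / 3 * (1 - √(3 * FQH.f (‖lam‖ ^ 2))) ^ 2 ≤ FQH.E1 L κ lam) := by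
  obtain hN : 3 ≤ N ∧ 3 * N + k ≤ L := by omega
  refine ⟨FQH.leavesInvariant_ham lam κ (by omega) le_rfl (by omega) le_rfl,
    fun n hn hnN => ?_, fun m hm hmN => ?_, fun n hn => FQH.norm_phi_sq_div_norm_phi_sq lam hn,
    FQH.bddAbove_fk (by positivity), fun n hn hnN => ⟨?_, fun m hm hmN => ?_, fun _ => ?_⟩,
    fun _ => FQH.le_E1 lam hκ hk hLN (by omega)⟩
  · have reduces_h := FQH.reduces_hLoc (L := L) lam hκ.le hk hn (by omega)
    exact ⟨reduces_h.leavesInvariant,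
      (FQH.reduces_hSum lam hκ.le hk (by omega)).leavesInvariant,
      reduces_h.kerProj.leavesInvariant⟩
  · exact (FQH.reduces_EProj lam hκ.le hk hm (by omega) hmN hN.2).leavesInvariant
  · exact FQH.smul_restr_one_sub_gProj_le lam hκ hk hn (by omega)
  · contrapose!
    intro outside
    exact sub_eq_zero.2 (FQH.commute_restr (FQH.reduces_hLoc lam hκ.le hk hn (by omega)).kerProj
      (FQH.reduces_EProj lam hκ.le hk hm (by omega) hmN hN.2)
      (FQH.commute_gProj_EProj lam hκ.le hk hn hnN hm hmN (by omega))).eq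
  · exact FQH.norm_restr_gProj_mul_restr_EProj_sq_le lam hκ hk hn hnN hN.2
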